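/- Throughout, structures are relational, with an arbitrary signature. A countable (possibly finite) structure $\mathbb A$ with domain $A$ is \emph{$\omega$-categorical} if for every $n$ the automorphism group of $\mathbb A$ has only finitely many orbits in its componentwise action on $A^n$. It is a \emph{model-complete core} if for every endomorphism $e$ of $\mathbb A$ and every finite $F\subseteq A$ there is an automorphism $\alpha$ of $\mathbb A$ with $e|_F=\alpha|_F$. A \emph{pp-formula} is built from atomic formulas (including equalities) by conjunctions and existential quantifiers. A structure $\mathbb A$ \emph{pp-interprets} a structure $\mathbb B$ with domain $B$ if there are $d\ge 1$ and a partial surjective map $h\colon A^d\to B$ such that the preimages under $h$ of $B$, of the equality relation on $B$, and of every relation of $\mathbb B$ (an $n$-ary relation giving an $nd$-ary relation on $A$) are definable in $\mathbb A$ by pp-formulas; $\mathbb A$ pp-interprets $\mathbb B$ \emph{with parameters} if the expansion of $\mathbb A$ by the unary relations $\{a\}$, $a\in A$, pp-interprets $\mathbb B$. A \emph{polymorphism} of $\mathbb A$ is an operation $f\colon A^m\to A$ which, applied componentwise, preserves every relation of $\mathbb A$; $\operatorname{Pol}(\mathbb A)$ is the set of all polymorphisms of $\mathbb A$. A system of identities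 between terms is \emph{satisfied} in $\operatorname{Pol}(\mathbb A)$ if its function symbols can be interpreted by polymorphisms of $\mathbb A$ so that all the identities hold for all values of the variables in $A$. It is \emph{trivial} if it is satisfied in $\operatorname{Pol}(\mathbb C)$ for every structure $\mathbb C$, and \emph{nontrivial} otherwise. For a finite digraph $\mathbb B$ (loops allowed) with vertices $1,\dots,n$ and edges $(i_1,j_1),\dots,(i_m,j_m)$, the \emph{$\mathbb B$-pseudoloop condition} is the single identity $$u(s(x_{i_1},\dots,x_{i_m}))\approx v(s(x_{j_1},\dots,x_{j_m}))$$ in the unary function symbols $u,v$ and the $m$-ary function symbol $s$. A \emph{pseudoloop condition} is the $\mathbb B$-pseudoloop condition for some finite digraph $\mathbb B$. \textbf{Theorem.} Let $\mathbb A$ be an $\omega$-categorical model-complete core. Then the following are equivalent: \begin{enumerate} \item $\mathbb A$ does not pp-interpret with parameters all finite structures; \item $\operatorname{Pol}(\mathbb A)$ satisfies some nontrivial pseudoloop condition; \item $\operatorname{Pol}(\mathbb A)$ satisfies the $\mathbb B$-pseudoloop condition for every symmetric non-bipartite finite digraph $\mathbb B$. \end{enumerate} -/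

import Mathlib

universe u v w u' v' w'

namespace PseudoloopConditions

open FirstOrder FirstOrder.Language FirstOrder.Language.Structure

/-! ### Orbits, ω-categoricity, model-complete cores -/

/-- Two `n`-tuples are equivalent if an automorphism of `A` maps one to the other;
the classes are the `n`-orbits of the automorphism group. -/
def orbitSetoid (L : FirstOrder.Language.{v, w}) (A : Type u) [L.Structure A] (n : ℕ) :
    Setoid (Fin n → A) where
  r x y := ∃ α : A ≃[L] A, ∀ i, α (x i) = y i
  iseqv :=
    { refl := fun _ => ⟨Language.Equiv.refl L A, fun _ => rfl⟩
      symm := fun ⟨α, h⟩ => ⟨α.symm, fun i => by rw [← h i]; exact α.symm_apply_apply _⟩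
      trans := fun ⟨α, h⟩ ⟨β, k⟩ =>
        ⟨β.comp α, fun i => by rw [Language.Equiv.comp_apply, h i, k i]⟩ }

/-- A countable structure whose automorphism group is oligomorphic, that is, has
finitely many `n`-orbits for every `n`. -/
def IsOmegaCategorical (L : FirstOrder.Language.{v, w}) (A : Type u) [L.Structure A] : Prop :=
  Countable A ∧ ∀ n : ℕ, Finite (Quotient (orbitSetoid L A n))

/-- Every endomorphism coincides on every finite set with some automorphism. -/
def IsModelCompleteCore (L : FirstOrder.Language.{v, w}) (A : Type u) [L.Structure A] : Prop :=
  ∀ (e : A →[L] A) (F : Finset A), ∃ α : A ≃[L] A, ∀ a ∈ F, e a = α a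

/-! ### Primitive positive definitions and interpretations -/

/-- Formulas built from atomic formulas (including equalities) by conjunction, the empty
conjunction `⊤` included, and existential quantification. -/
inductive IsPrimitivePositive {L : FirstOrder.Language.{v, w}} {ι : Type u'} :
    {n : ℕ} → L.BoundedFormula ι n → Prop
  | atomic {n : ℕ} {φ : L.BoundedFormula ι n} (h : φ.IsAtomic) : IsPrimitivePositive φ
  | top {n : ℕ} : IsPrimitivePositive (⊤ : L.BoundedFormula ι n)
  | inf {n : ℕ} {φ ψ : L.BoundedFormula ι n} (hφ : IsPrimitivePositive φ)
      (hψ : IsPrimitivePositive ψ) : IsPrimitivePositive (φ ⊓ ψ)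
  | ex {n : ℕ} {φ : L.BoundedFormula ι (n + 1)} (h : IsPrimitivePositive φ) :
      IsPrimitivePositive φ.ex

/-- The relation `S` on `A`, with coordinates indexed by `ι`, has a pp-definition in `A`. -/
def PPDefinable (L : FirstOrder.Language.{v, w}) {A : Type u} [L.Structure A] {ι : Type u'}
    (S : Set (ι → A)) : Prop :=
  ∃ φ : L.Formula ι, IsPrimitivePositive φ ∧ ∀ x : ι → A, φ.Realize x ↔ x ∈ S

/-- The preimage of an `n`-ary relation `R` on `B` under a partial map `h` from `A ^ d` to `B`,
seen as an `n * d`-ary relation on `A`. -/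
def preimageRel {A : Type u} {B : Type u'} {d n : ℕ} (h : (Fin d → A) →. B)
    (R : Set (Fin n → B)) : Set (Fin n × Fin d → A) :=
  {x | ∃ b ∈ R, ∀ i : Fin n, b i ∈ h fun j => x (i, j)}

/-- The partial surjective map `h` is a pp-interpretation of `B` in `A`. -/
structure IsPPInterpretation (L : FirstOrder.Language.{v, w}) (A : Type u) [L.Structure A]
    (L' : FirstOrder.Language.{v', w'}) (B : Type u') [L'.Structure B] {d : ℕ}
    (h : (Fin d → A) →. B) : Prop where
  pos : 1 ≤ d
  surj : ∀ b : B, ∃ x, b ∈ h x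
  domain : PPDefinable L (preimageRel h (Set.univ : Set (Fin 1 → B)))
  equality : PPDefinable L (preimageRel h {b : Fin 2 → B | b 0 = b 1})
  relations : ∀ {n : ℕ} (R : L'.Relations n),
    PPDefinable L (preimageRel h {b : Fin n → B | RelMap R b})

/-- The structure `A` pp-interprets the structure `B`. -/
def PPInterprets (L : FirstOrder.Language.{v, w}) (A : Type u) [L.Structure A]
    (L' : FirstOrder.Language.{v', w'}) (B : Type u') [L'.Structure B] : Prop :=
  ∃ (d : ℕ) (h : (Fin d → A) →. B), IsPPInterpretation L A L' B h

/-- One unary relation symbol for each element of `A`. -/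
inductive ParamSymbol (A : Type u) : ℕ → Type u
  | single (a : A) : ParamSymbol A 1

/-- The language with one unary relation symbol for each element of `A`. -/
def paramLanguage (A : Type u) : FirstOrder.Language.{0, u} :=
  ⟨fun _ => Empty, ParamSymbol A⟩

/-- The symbol belonging to `a` is interpreted as `{a}`. -/
instance paramStructure (A : Type u) : (paramLanguage A).Structure A where
  funMap := fun f _ => nomatch f
  RelMap := fun R x =>
    match R, x with
    | ParamSymbol.single a, x => x 0 = a

/-- The structure `A`, expanded by all the unary relations `{a}`, pp-interprets `B`. -/
def PPInterpretsWithParameters (L : FirstOrder.Language.{v, w}) (A : Type u) [L.Structure A]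
    (L' : FirstOrder.Language.{v', w'}) (B : Type u') [L'.Structure B] : Prop :=
  PPInterprets (L.sum (paramLanguage A)) A L' B

/-- The structure `A` pp-interprets with parameters all finite relational structures. -/
def PPInterpretsAllFiniteWithParameters (L : FirstOrder.Language.{v, w}) (A : Type u)
    [L.Structure A] : Prop :=
  ∀ (L' : FirstOrder.Language.{0, 0}) [L'.IsRelational] (B : Type) [L'.Structure B] [Finite B],
    PPInterpretsWithParameters L A L' B

/-! ### Polymorphisms and equational conditions -/

/-- The operation `f` preserves every relation of `A`. -/
def IsPolymorphism (L : FirstOrder.Language.{v, w}) {A : Type u} [L.Structure A] {m : ℕ}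
    (f : (Fin m → A) → A) : Prop :=
  ∀ {n : ℕ} (R : L.Relations n) (r : Fin m → Fin n → A),
    (∀ i, RelMap R (r i)) → RelMap R fun j => f fun i => r i j

/-- A system of identities between terms over common function symbols and variables. -/
structure EquationalCondition where
  symbols : FirstOrder.Language.{0, 0}
  isAlgebraic : symbols.IsAlgebraic
  Var : Type
  identities : Set (symbols.Term Var × symbols.Term Var)

/-- The function symbols of `E` can be interpreted by polymorphisms of `A` so that all the
identities of `E` hold for all evaluations of the variables. -/
def PolSatisfies (L : FirstOrder.Language.{v, w}) (A : Type u) [L.Structure A]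
    (E : EquationalCondition) : Prop :=
  ∃ I : E.symbols.Structure A,
    (∀ {m : ℕ} (f : E.symbols.Functions m), IsPolymorphism L (I.funMap f)) ∧
    ∀ p ∈ E.identities, ∀ ρ : E.Var → A,
      (p.1.realize ρ : A) = p.2.realize ρ

/-- An equational condition is trivial if it is satisfied in every polymorphism clone. -/
def EquationalCondition.IsTrivial (E : EquationalCondition) : Prop :=
  ∀ (L : FirstOrder.Language.{0, 0}) [L.IsRelational] (A : Type) [L.Structure A], PolSatisfies L A E

/-! ### Pseudoloop conditions -/

/-- Two unary symbols `u`, `v` and one `m`-ary symbol `s`. -/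
inductive PseudoloopSymbol (m : ℕ) : ℕ → Type
  | u : PseudoloopSymbol m 1
  | v : PseudoloopSymbol m 1
  | s : PseudoloopSymbol m m

/-- The language with function symbols `u`, `v`, `s` and no relation symbols. -/
def pseudoloopLanguage (m : ℕ) : FirstOrder.Language.{0, 0} :=
  ⟨PseudoloopSymbol m, fun _ => Empty⟩

/-- The edges of a digraph. -/
abbrev Edge {V : Type} (B : Digraph V) : Type := {p : V × V // B.Adj p.1 p.2}

/-- The list of all edges of a finite digraph, in an arbitrary order. -/
noncomputable def edgeList {V : Type} [Finite V] (B : Digraph V) :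
    Fin (Nat.card (Edge B)) ≃ Edge B :=
  (Finite.equivFin (Edge B)).symm

/-- For a digraph with edges `(i₁, j₁), …, (iₘ, jₘ)` the condition is
`u (s (x_{i₁}, …, x_{iₘ})) ≈ v (s (x_{j₁}, …, x_{jₘ}))`, with the vertices as variables. -/
noncomputable def pseudoloopCondition {V : Type} [Finite V] (B : Digraph V) :
    EquationalCondition where
  symbols := pseudoloopLanguage (Nat.card (Edge B))
  isAlgebraic := fun _ => inferInstanceAs (IsEmpty Empty)
  Var := V
  identities :=
    {(Term.func (l := 1) PseudoloopSymbol.u fun _ =>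
        Term.func (l := Nat.card (Edge B)) PseudoloopSymbol.s fun k =>
          Term.var (edgeList B k).1.1,
      Term.func (l := 1) PseudoloopSymbol.v fun _ =>
        Term.func (l := Nat.card (Edge B)) PseudoloopSymbol.s fun k =>
          Term.var (edgeList B k).1.2)}

/-- The vertices can be split in two classes with no edge (in particular, no loop) inside
a class. -/
def IsBipartite {V : Type} (B : Digraph V) : Prop :=
  ∃ c : V → Bool, ∀ x y, B.Adj x y → c x ≠ c y

end PseudoloopConditions

/-! The substance is 1 → 3, by contraposition. If the condition of a symmetric non-bipartite digraph
fails, then by compactness (`exists_mem_of_isLocal`) it already fails on a finite set of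
evaluations. Applying all polymorphisms to these gives an invariant symmetric graph on tuples with
an odd closed walk but no edge inside an orbit (`exists_isPoly_sameOrbit`). Such a graph forces
interpretations of all finite structures (`IsOddGraph.interpretsAll`), for topological reasons.

Choose a minimal invariant union of orbits carrying such a graph, and shorten the odd walk to a
triangle modulo orbits. Minimality gives the finite graph of orbits an integer cocycle, the height,
that vanishes on squares of the bipartite double but not on some triangle run through twice
(`MinimalGraph.exists_isHeight`). Oligomorphicity turns this into a genuine closed walk of nonzero
height (`interpretsAll_of_triangle`).

Heights behave like a homomorphism on a fundamental group: on a product of closed walks they split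
as a sum over the factors (`walkHeight_product`). So the binary polymorphisms fixing two adjacent
base points act on height vectors by additive maps. In a core these vectors depend only on the
orbits visited, so the operators form a finite set in a torsion-free ring, closed under x y + (1 -
x) z. Such a set consists of commuting idempotents, and on the image of a minimal one every operator
is 0 or 1. The coefficients of a polymorphism there sum to 1, so exactly one of them is 1:
polymorphisms act as projections on two classes of closed walks (`HeightData.exists_projection`).
The two classes serve as bits, every relation on words of bits is invariant, and invariant relations
are pp-definable with parameters (`ActsByProjections.interpretsAll`).

For 2 → 1, interpreting `Bool` with all its relations makes the polymorphisms, corrected to fix the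
parameters, act as projections, and these violate the condition of a loopless digraph. For 3 → 2 the
triangle suffices. -/

section RingOfOperators

/-! ### Finite sets of operators in a torsion-free ring -/

variable {R : Type*} [Ring R]

/-- In a torsion-free ring a nilpotent `s` for which some positive power of `1 - s` is `1`
vanishes. -/
theorem eq_zero_of_isNilpotent_of_one_sub_pow_eq_one
    (htf : ∀ (n : ℕ) (x : R), n ≠ 0 → (n : R) * x = 0 → x = 0)
    {s : R} (hs : IsNilpotent s) {j : ℕ} (hj : j ≠ 0) (h1 : (1 - s) ^ j = 1) : s = 0 := by
  classical
  by_contra hne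
  have hex : ∃ c, s ^ c = 0 := hs
  set c := Nat.find hex with hc
  have hc0 : s ^ c = 0 := Nat.find_spec hex
  have hmin : ∀ m < c, s ^ m ≠ 0 := fun m hm => Nat.find_min hex hm
  have hc2 : 2 ≤ c := by
    by_contra hlt
    have : c = 0 ∨ c = 1 := by omega
    rcases this with h | h
    · rw [h, pow_zero] at hc0
      exact hne (by rw [← mul_one s, hc0, mul_zero])
    · rw [h, pow_one] at hc0
      exact hne hc0
  obtain ⟨d, hd⟩ : ∃ d, c = d + 2 := ⟨c - 2, by omega⟩
  -- Times s ^ d, the binomial expansion of (1 - s) ^ i stops after the linear term because s ^ (d +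
  -- 2) = 0. At i = j this leaves j s ^ (d + 1) = 0, against the minimality of c.
  have key : ∀ i : ℕ, (1 - s) ^ i * s ^ d = s ^ d - (i : R) * s ^ (d + 1) := by
    intro i
    induction i with
    | zero => simp
    | succ i ih =>
      have hz : s * ((i : R) * s ^ (d + 1)) = 0 := by
        rw [← mul_assoc, (Nat.cast_commute i s).symm.eq, mul_assoc, ← pow_succ', ← hd, hc0,
          mul_zero]
      rw [pow_succ', mul_assoc, ih, sub_mul, one_mul, mul_sub, hz, ← pow_succ']
      push_cast
      rw [add_mul, one_mul]
      abel
  have := key j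
  rw [h1, one_mul] at this
  have h0 : (j : R) * s ^ (d + 1) = 0 := by
    have := sub_eq_self.mp this.symm
    exact this
  exact hmin (d + 1) (by omega) (htf j _ hj h0)

/-- A finite set of elements of a ring closed under the operations that the coefficients of an
idempotent clone of linear operations are closed under. -/
structure IsCoefficientSet (S : Set R) : Prop where
  finite : S.Finite
  one : (1 : R) ∈ S
  compl : ∀ x ∈ S, 1 - x ∈ S
  comb : ∀ x ∈ S, ∀ y ∈ S, ∀ z ∈ S, x * y + (1 - x) * z ∈ S

namespace IsCoefficientSet

variable {S : Set R} (hS : IsCoefficientSet S)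

include hS

theorem zero : (0 : R) ∈ S := by simpa using hS.compl 1 hS.one

theorem mul {x y : R} (hx : x ∈ S) (hy : y ∈ S) : x * y ∈ S := by
  simpa using hS.comb x hx y hy 0 hS.zero

theorem pow {x : R} (hx : x ∈ S) (n : ℕ) : x ^ n ∈ S := by
  induction n with
  | zero => simpa using hS.one
  | succ n ih => rw [pow_succ]; exact hS.mul ih hx

theorem exists_pow_eq {x : R} (hx : x ∈ S) : ∃ a j : ℕ, j ≠ 0 ∧ x ^ a = x ^ (a + j) := by
  have : ¬ Function.Injective fun n : ℕ => (⟨x ^ n, hS.pow hx n⟩ : S) := by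
    have := hS.finite.to_subtype
    exact not_injective_infinite_finite _
  simp only [Function.Injective, not_forall, Subtype.mk.injEq] at this
  obtain ⟨a, b, hab, hne⟩ := this
  rcases lt_or_gt_of_ne hne with h | h
  · exact ⟨a, b - a, by omega, by rw [hab]; congr 1; omega⟩
  · exact ⟨b, a - b, by omega, by rw [← hab]; congr 1; omega⟩

/-- The element s = 2 (x - x²) is in S since 1 - s = x² + (1 - x)². Its powers repeat periodically
and are divisible by growing powers of 2, so s is nilpotent. Then 1 - s is a unit whose powers
repeat, hence of finite order, and s = 0 by `eq_zero_of_isNilpotent_of_one_sub_pow_eq_one`. -/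
theorem isIdempotentElem
    (htf : ∀ (n : ℕ) (x : R), n ≠ 0 → (n : R) * x = 0 → x = 0)
    (hsep : ∀ x : R, (∀ n : ℕ, ∃ y, x = 2 ^ n * y) → x = 0)
    {x : R} (hx : x ∈ S) : x * x = x := by
  set s : R := 2 * (x - x * x) with hs
  have hsS : s ∈ S := by
    have h1 := hS.compl _ (hS.comb x hx x hx (1 - x) (hS.compl x hx))
    have : 1 - (x * x + (1 - x) * (1 - x)) = s := by rw [hs]; noncomm_ring
    rwa [this] at h1
  have hpow : ∀ n : ℕ, s ^ n = 2 ^ n * (x - x * x) ^ n := by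
    intro n
    rw [hs, (Commute.ofNat_left 2 (x - x * x)).mul_pow]
  have hnil : IsNilpotent s := by
    obtain ⟨a, j, hj, haj⟩ := hS.exists_pow_eq hsS
    refine ⟨a, hsep _ fun n => ?_⟩
    have hit : ∀ i : ℕ, s ^ a = s ^ (a + i * j) := by
      intro i
      induction i with
      | zero => simp
      | succ i ih =>
        rw [ih, pow_add, haj, ← pow_add]
        congr 1; ring
    have hle : n ≤ a + n * j := by nlinarith [Nat.one_le_iff_ne_zero.mpr hj]
    obtain ⟨r, hr⟩ := Nat.exists_eq_add_of_le hle
    refine ⟨2 ^ r * (x - x * x) ^ (a + n * j), ?_⟩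
    rw [hit n, hpow, ← mul_assoc, ← pow_add, ← hr]
  have hs0 : s = 0 := by
    obtain ⟨a, j, hj, haj⟩ := hS.exists_pow_eq (hS.compl s hsS)
    refine eq_zero_of_isNilpotent_of_one_sub_pow_eq_one htf hnil hj ?_
    have hu : IsUnit ((1 - s) ^ a) := hnil.isUnit_one_sub.pow a
    rw [pow_add] at haj
    exact hu.mul_left_cancel (by rw [mul_one]; exact haj.symm)
  have := htf 2 (x - x * x) two_ne_zero (by simpa [hs] using hs0)
  exact (sub_eq_zero.mp this).symm

/-- Both (1 - x) y x and x y (1 - x) lie in S and square to zero; being idempotent, they vanish. So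
y x and x y both equal x y x. -/
theorem mul_comm_of_idem (hid : ∀ x ∈ S, x * x = x) {x y : R} (hx : x ∈ S) (hy : y ∈ S) :
    x * y = y * x := by
  have e : x * (1 - x) = 0 := by rw [mul_sub, mul_one, hid x hx, sub_self]
  have h1 : (1 - x) * y * x = 0 := by
    rw [← hid _ (hS.mul (hS.mul (hS.compl x hx) hy) hx)]
    calc (1 - x) * y * x * ((1 - x) * y * x) = (1 - x) * y * (x * (1 - x)) * (y * x) := by
          simp only [mul_assoc]
      _ = 0 := by rw [e]; simp
  have h2 : x * y * (1 - x) = 0 := by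
    have e' : (1 - x) * x = 0 := by rw [sub_mul, one_mul, hid x hx, sub_self]
    rw [← hid _ (hS.mul (hS.mul hx hy) (hS.compl x hx))]
    calc x * y * (1 - x) * (x * y * (1 - x)) = x * y * ((1 - x) * x) * (y * (1 - x)) := by
          simp only [mul_assoc]
      _ = 0 := by rw [e']; simp
  have h3 : y * x = x * y * x := by
    rw [sub_mul, one_mul, sub_mul] at h1; exact sub_eq_zero.mp h1
  have h4 : x * y = x * y * x := by
    rw [mul_sub, mul_one] at h2; exact sub_eq_zero.mp h2
  rw [h4, h3]

/-- E is chosen nonzero with as few x ∈ S as possible satisfying x E ≠ 0. If x E were neither 0 nor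
E, then x E would be a better choice, because 1 - x kills x E but not E. -/
theorem exists_minimal
    (htf : ∀ (n : ℕ) (x : R), n ≠ 0 → (n : R) * x = 0 → x = 0)
    (hsep : ∀ x : R, (∀ n : ℕ, ∃ y, x = 2 ^ n * y) → x = 0) (h10 : (1 : R) ≠ 0) :
    ∃ E ∈ S, E ≠ 0 ∧ ∀ x ∈ S, x * E = 0 ∨ x * E = E := by
  have hid : ∀ x ∈ S, x * x = x := fun x hx => hS.isIdempotentElem htf hsep hx
  have hfin : ({E | E ∈ S ∧ E ≠ 0} : Set R).Finite := hS.finite.subset fun x hx => hx.1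
  obtain ⟨E, ⟨hE, hE0⟩, hmin⟩ := Set.exists_min_image {E | E ∈ S ∧ E ≠ 0}
    (fun E => {x | x ∈ S ∧ x * E ≠ 0}.ncard) hfin ⟨1, hS.one, h10⟩
  refine ⟨E, hE, hE0, fun x hx => ?_⟩
  by_contra! hcon
  obtain ⟨h1, h2⟩ := hcon
  have hfin' : ({y | y ∈ S ∧ y * E ≠ 0} : Set R).Finite := hS.finite.subset fun x hx => hx.1
  have := hmin (x * E) ⟨hS.mul hx hE, h1⟩
  refine absurd this (not_le.mpr (Set.ncard_lt_ncard ⟨?_, ?_⟩ hfin'))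
  · rintro y ⟨hy, hyx⟩
    refine ⟨hy, fun h => hyx ?_⟩
    rw [hS.mul_comm_of_idem hid hx hE, ← mul_assoc, h, zero_mul]
  · intro hsub
    have hmem : 1 - x ∈ {y | y ∈ S ∧ y * E ≠ 0} :=
      ⟨hS.compl x hx, by rw [sub_mul, one_mul]; exact sub_ne_zero.mpr (Ne.symm h2)⟩
    refine (hsub hmem).2 ?_
    rw [← mul_assoc, sub_mul, one_mul, hid x hx, sub_self, zero_mul]

end IsCoefficientSet

end RingOfOperators

namespace PseudoloopConditions

open FirstOrder FirstOrder.Language FirstOrder.Language.Structure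

/-! ### Polymorphisms and orbits of tuples -/

section Clone

variable (L : FirstOrder.Language.{v, w}) {A : Type u} [L.Structure A]

/-- Polymorphisms with an arbitrary index type for their arguments. -/
def IsPoly {σ : Type*} (f : (σ → A) → A) : Prop :=
  ∀ {n : ℕ} (R : L.Relations n) (r : σ → Fin n → A),
    (∀ i, RelMap R (r i)) → RelMap R fun j => f fun i => r i j

/-- The componentwise action of an operation on tuples. -/
def lift {σ ι : Type*} (f : (σ → A) → A) (r : σ → ι → A) : ι → A := fun j => f fun i => r i j

/-- `f` is idempotent on the elements of `C`. -/
def Fixes {σ : Type*} (f : (σ → A) → A) (C : Set A) : Prop := ∀ c ∈ C, (f fun _ => c) = c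

/-- The set `S` of tuples is preserved by all polymorphisms of finite arity that fix `C`. -/
def IsInvariant (C : Set A) {ι : Type*} (S : Set (ι → A)) : Prop :=
  ∀ {m : ℕ} (f : (Fin m → A) → A), IsPoly L f → Fixes f C →
    ∀ r : Fin m → ι → A, (∀ i, r i ∈ S) → lift f r ∈ S

/-- Two tuples lie in the same orbit of the automorphism group. -/
def SameOrbit {ι : Type*} (x y : ι → A) : Prop := ∃ α : A ≃[L] A, ∀ i, α (x i) = y i

variable {L}

theorem SameOrbit.refl {ι : Type*} (x : ι → A) : SameOrbit L x x :=
  ⟨Language.Equiv.refl L A, fun _ => rfl⟩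

theorem SameOrbit.symm {ι : Type*} {x y : ι → A} (h : SameOrbit L x y) : SameOrbit L y x := by
  obtain ⟨α, h⟩ := h
  exact ⟨α.symm, fun i => by rw [← h i]; exact α.symm_apply_apply _⟩

theorem SameOrbit.trans {ι : Type*} {x y z : ι → A} (h : SameOrbit L x y)
    (k : SameOrbit L y z) : SameOrbit L x z := by
  obtain ⟨α, h⟩ := h
  obtain ⟨β, k⟩ := k
  exact ⟨β.comp α, fun i => by rw [Language.Equiv.comp_apply, h i, k i]⟩

theorem SameOrbit.comp {ι κ : Type*} {x y : ι → A} (h : SameOrbit L x y) (e : κ → ι) :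
    SameOrbit L (x ∘ e) (y ∘ e) := by
  obtain ⟨α, h⟩ := h
  exact ⟨α, fun i => h (e i)⟩

theorem isPoly_proj {σ : Type*} (i : σ) : IsPoly L fun x : σ → A => x i :=
  fun _ _ h => h i

theorem IsPoly.comp {σ τ : Type*} {f : (σ → A) → A} (hf : IsPoly L f)
    {g : σ → (τ → A) → A} (hg : ∀ i, IsPoly L (g i)) : IsPoly L fun x => f fun i => g i x :=
  fun R r h => hf R (fun i j => g i fun k => r k j) fun i => hg i R r h

theorem IsPoly.reindex {σ τ : Type*} {f : (σ → A) → A} (hf : IsPoly L f) (e : σ → τ) :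
    IsPoly L fun x : τ → A => f fun i => x (e i) :=
  hf.comp (g := fun i x => x (e i)) fun i => isPoly_proj (e i)

theorem isPoly_equiv_comp {σ : Type*} (α : A ≃[L] A) {f : (σ → A) → A} (hf : IsPoly L f) :
    IsPoly L fun x => α (f x) :=
  fun R r h => (α.map_rel R fun j => f fun i => r i j).mpr (hf R r h)

/-- The endomorphism obtained by composing a polymorphism with automorphisms. -/
def endOfPoly [L.IsRelational] {σ : Type*} {f : (σ → A) → A} (hf : IsPoly L f)
    (α : σ → (A ≃[L] A)) : A →[L] A where
  toFun a := f fun i => α i a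
  map_fun' := fun f => isEmptyElim f
  map_rel' := fun R x h => hf R (fun i j => α i (x j)) fun i => ((α i).map_rel R x).mpr h

/-- With r i = α i t, the unary map a ↦ f (α i a) is an endomorphism, which agrees with an
automorphism on the entries of t. Thus in a core every orbit is preserved by polymorphisms. -/
theorem IsPoly.sameOrbit [L.IsRelational] (hcore : IsModelCompleteCore L A) {σ ι : Type*}
    [Finite ι] {f : (σ → A) → A} (hf : IsPoly L f) {t : ι → A} {r : σ → ι → A}
    (hr : ∀ i, SameOrbit L t (r i)) : SameOrbit L t (lift f r) := by
  classical
  have := Fintype.ofFinite ι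
  choose α hα using hr
  obtain ⟨β, hβ⟩ := hcore (endOfPoly hf α) (Finset.univ.image t)
  refine ⟨β, fun j => ?_⟩
  rw [← hβ (t j) (Finset.mem_image_of_mem _ (Finset.mem_univ _))]
  change (f fun i => α i (t j)) = f fun i => r i j
  simp only [hα]

/-- The equivalence of tuples modulo automorphisms, for any index type. -/
def tupleSetoid (L : FirstOrder.Language.{v, w}) (A : Type u) [L.Structure A] (ι : Type*) :
    Setoid (ι → A) where
  r := SameOrbit L
  iseqv := ⟨SameOrbit.refl, SameOrbit.symm, SameOrbit.trans⟩

theorem IsOmegaCategorical.finite_orbits (hcat : IsOmegaCategorical L A) (ι : Type*) [Finite ι] :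
    Finite (Quotient (tupleSetoid L A ι)) := by
  obtain ⟨n, ⟨e⟩⟩ := Finite.exists_equiv_fin ι
  have := hcat.2 n
  refine Finite.of_surjective
    (Quotient.lift (s := orbitSetoid L A n) (fun x => Quotient.mk (tupleSetoid L A ι) (x ∘ e))
      fun x y h => Quotient.sound (s := tupleSetoid L A ι)
        (SameOrbit.comp (L := L) (x := x) (y := y) h e)) ?_
  intro q
  obtain ⟨x, rfl⟩ := Quotient.exists_rep q
  refine ⟨Quotient.mk _ (x ∘ e.symm), congrArg (Quotient.mk _) (funext fun i => ?_)⟩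
  exact congrArg x (e.symm_apply_apply i)

end Clone

/-! ### Compactness for oligomorphic automorphism groups -/

section Compactness

variable {L : FirstOrder.Language.{v, w}} {A : Type u} [L.Structure A]

/-- A set of functions that depends on finitely many coordinates and is closed under the
automorphism group. -/
def IsLocal (L : FirstOrder.Language.{v, w}) {A : Type u} [L.Structure A] {I : Type*}
    (S : Set (I → A)) : Prop :=
  ∃ s : Finset I, ∀ g g' : I → A, (∃ α : A ≃[L] A, ∀ i ∈ s, α (g i) = g' i) → g ∈ S → g' ∈ S

/-- Oligomorphic compactness: a family of local conditions that is finitely satisfiable is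
satisfiable. -/
theorem exists_mem_of_isLocal (hcat : IsOmegaCategorical L A) {I : Type*} [Countable I]
    {J : Type*} (S : J → Set (I → A)) (hloc : ∀ j, IsLocal L (S j))
    (hfin : ∀ F : Finset J, ∃ g : I → A, ∀ j ∈ F, g ∈ S j) : ∃ g : I → A, ∀ j, g ∈ S j := by
  classical
  rcases isEmpty_or_nonempty I with hI | hI
  · obtain ⟨g, -⟩ := hfin ∅
    refine ⟨g, fun j => ?_⟩
    obtain ⟨g', hg'⟩ := hfin {j}
    rw [Subsingleton.elim g g']
    exact hg' j (Finset.mem_singleton_self j)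
  obtain ⟨enum, henum⟩ := exists_surjective_nat I
  obtain ⟨U, hU'⟩ : ∃ U : Ultrafilter (I → A), Set.range S ⊆ (U : Filter (I → A)).sets := by
    refine Ultrafilter.exists_ultrafilter_of_finite_inter_nonempty _ fun T hT => ?_
    choose k hk using fun t : T => hT t.2
    obtain ⟨g, hg⟩ := hfin (Finset.univ.image k)
    refine ⟨g, fun t ht => ?_⟩
    have := hg _ (Finset.mem_image_of_mem k (Finset.mem_univ ⟨t, ht⟩))
    rwa [hk] at this
  have hU : ∀ j, S j ∈ U := fun j => hU' ⟨j, rfl⟩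
  -- The functions that look like G on the first n entries up to an automorphism. The approximations
  -- G are built so that this set stays in the ultrafilter.
  let T : ℕ → (I → A) → Set (I → A) := fun n G =>
    {g | ∃ α : A ≃[L] A, ∀ i < n, α (g (enum i)) = G (enum i)}
  have step : ∀ n (G : {G : I → A // T n G ∈ U}),
      ∃ G' : {G : I → A // T (n + 1) G ∈ U}, ∀ i < n, G'.1 (enum i) = G.1 (enum i) := by
    rintro n ⟨G, hG⟩
    let q : (I → A) → Quotient (tupleSetoid L A (Fin (n + 1))) :=
      fun g => Quotient.mk _ fun i => g (enum i)
    -- There are finitely many orbits of (n + 1)-tuples, so the ultrafilter concentrates on one of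
    -- them. A representative is moved by α so as to keep the n values already fixed.
    have := hcat.finite_orbits (Fin (n + 1))
    obtain ⟨c, hc⟩ := Ultrafilter.eq_pure_of_finite (U.map q)
    have hcU : q ⁻¹' {c} ∈ U := by
      have : ({c} : Set _) ∈ U.map q := by rw [hc]; exact Set.mem_singleton c
      exact this
    obtain ⟨g0, ⟨α, hα⟩, hg0⟩ := U.nonempty_of_mem (Filter.inter_mem hG hcU)
    refine ⟨⟨fun i => α (g0 i), ?_⟩, fun i hi => hα i hi⟩
    refine Filter.mem_of_superset hcU fun g hg => ?_
    have hgg : q g = q g0 := hg.trans hg0.symm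
    obtain ⟨β, hβ⟩ := Quotient.exact hgg
    refine ⟨α.comp β, fun i hi => ?_⟩
    rw [Language.Equiv.comp_apply]
    exact congrArg α (hβ ⟨i, hi⟩)
  choose next hnext using step
  obtain ⟨g00, -⟩ := hfin ∅
  let G : (n : ℕ) → {G : I → A // T n G ∈ U} := fun n =>
    Nat.rec ⟨g00, by
      refine Filter.mem_of_superset Filter.univ_mem fun g _ => ⟨Language.Equiv.refl L A, ?_⟩
      intro i hi; exact absurd hi (Nat.not_lt_zero i)⟩ (fun n G => next n G) n
  have hG : ∀ n k, ∀ i < n, (G (n + k)).1 (enum i) = (G n).1 (enum i) := by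
    intro n k i hi
    induction k with
    | zero => rfl
    | succ k ih => exact (hnext (n + k) (G (n + k)) i (by omega)).trans ih
  have hG' : ∀ n m, ∀ i, i < n → i < m → (G n).1 (enum i) = (G m).1 (enum i) := by
    intro n m i hn hm
    rw [← hG n m i hn, ← hG m n i hm, Nat.add_comm]
  choose idx hidx using henum
  let g : I → A := fun i => (G (idx i + 1)).1 i
  have hg : ∀ n, ∀ i < n, g (enum i) = (G n).1 (enum i) := by
    intro n i hi
    have h1 := hG' (idx (enum i) + 1) (max n (idx (enum i) + 1)) (idx (enum i)) (by omega)
      (by omega)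
    have h2 := hG' n (max n (idx (enum i) + 1)) i hi (by omega)
    rw [hidx] at h1
    exact h1.trans h2.symm
  refine ⟨g, fun j => ?_⟩
  obtain ⟨s, hs⟩ := hloc j
  set n := (s.image idx).sup id + 1 with hn
  obtain ⟨g1, hg1, α, hα⟩ := U.nonempty_of_mem (Filter.inter_mem (hU j) (G n).2)
  refine hs g1 g ⟨α, fun i hi => ?_⟩ hg1
  have hlt : idx i < n :=
    Nat.lt_succ_of_le (Finset.le_sup (f := id) (Finset.mem_image_of_mem idx hi))
  have h1 := hα (idx i) hlt
  have h2 := hg n (idx i) hlt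
  rw [hidx] at h1 h2
  rw [h1, h2]

end Compactness

/-! ### Invariant relations are pp-definable with parameters -/

section Definability

theorem IsPrimitivePositive.exs {L : FirstOrder.Language.{v, w}} {ι : Type u'} {n : ℕ}
    {φ : L.BoundedFormula ι n} (h : IsPrimitivePositive φ) : IsPrimitivePositive φ.exs := by
  induction n with
  | zero => exact h
  | succ n ih => exact ih h.ex

theorem IsPrimitivePositive.foldr_inf {L : FirstOrder.Language.{v, w}} {ι : Type u'} {n : ℕ}
    {l : List (L.BoundedFormula ι n)} (h : ∀ φ ∈ l, φ.IsAtomic) :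
    IsPrimitivePositive (l.foldr (· ⊓ ·) ⊤) := by
  induction l with
  | nil => exact .top
  | cons φ l ih =>
    exact .inf (.atomic (h φ List.mem_cons_self)) (ih fun ψ hψ => h ψ (List.mem_cons_of_mem _ hψ))

/-- An existentially quantified finite conjunction of atomic formulas is a pp-definition. -/
theorem ppDefinable_of_atomics {L : FirstOrder.Language.{v, w}} {A : Type u} [L.Structure A]
    {ι : Type u'} {n : ℕ} (l : List (L.BoundedFormula ι n)) (h : ∀ φ ∈ l, φ.IsAtomic) :
    PPDefinable L {x : ι → A | ∃ y : Fin n → A, ∀ φ ∈ l, φ.Realize x y} := by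
  refine ⟨(l.foldr (· ⊓ ·) ⊤).exs, (IsPrimitivePositive.foldr_inf h).exs, fun x => ?_⟩
  rw [BoundedFormula.realize_exs]
  simp only [BoundedFormula.realize_foldr_inf, Set.mem_ofPred_eq]

variable (L : FirstOrder.Language.{v, w}) {A : Type u} [L.Structure A]

/-- One instance of the condition that a `σ`-ary operation preserves the relations. -/
structure Constraint (A : Type u) [L.Structure A] (σ : Type*) where
  arity : ℕ
  rel : L.Relations arity
  rows : σ → Fin arity → A
  holds : ∀ i, RelMap rel (rows i)

variable {L}

/-- The operation `f` satisfies the constraint `c`. -/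
def Constraint.Sat {σ : Type*} (c : Constraint L A σ) (f : (σ → A) → A) : Prop :=
  RelMap c.rel (lift f c.rows)

theorem isPoly_iff_sat {σ : Type*} {f : (σ → A) → A} :
    IsPoly L f ↔ ∀ c : Constraint L A σ, c.Sat f :=
  ⟨fun h c => h c.rel c.rows c.holds, fun h _ R r hr => h ⟨_, R, r, hr⟩⟩

/-- The tuples that arise from the rows of `t` by operations satisfying finitely many constraints
and fixing finitely many elements are pp-definable with parameters. -/
theorem ppDefinable_of_constraints [Nonempty A] {ι : Type u'} [Finite ι] {k : ℕ}
    (t : Fin k → ι → A) (C : Finset A) (F : Finset (Constraint L A (Fin k))) :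
    PPDefinable (L.sum (paramLanguage A))
      {x : ι → A | ∃ f : (Fin k → A) → A, (∀ j, lift f t j = x j) ∧ (∀ c ∈ C, (f fun _ => c) = c) ∧
        ∀ c ∈ F, c.Sat f} := by
  classical
  have := Fintype.ofFinite ι
  obtain ⟨a0⟩ := ‹Nonempty A›
  -- These are the arguments at which the value of f matters; each value becomes an existentially
  -- quantified variable. The constant tuple at `a0` only provides a default index for `num`.
  let P : Finset (Fin k → A) := insert (fun _ => a0) ((Finset.univ.image fun j i => t i j) ∪
    (C.image fun c _ => c) ∪ F.biUnion fun c => Finset.univ.image fun j i => c.rows i j)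
  let e := P.equivFin
  have h0 : (fun _ => a0) ∈ P := Finset.mem_insert_self _ _
  let num : (Fin k → A) → Fin P.card := fun p =>
    if h : p ∈ P then e ⟨p, h⟩ else e ⟨_, h0⟩
  have hnum : ∀ p ∈ P, (e.symm (num p)).1 = p := by
    intro p hp
    simp only [num, dif_pos hp, Equiv.symm_apply_apply]
  have hPt : ∀ j, (fun i => t i j) ∈ P := fun j => by
    refine Finset.mem_insert_of_mem (Finset.mem_union_left _ (Finset.mem_union_left _ ?_))
    exact Finset.mem_image_of_mem _ (Finset.mem_univ j)
  have hPC : ∀ c ∈ C, (fun _ => c) ∈ P := fun c hc => by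
    refine Finset.mem_insert_of_mem (Finset.mem_union_left _ (Finset.mem_union_right _ ?_))
    exact Finset.mem_image_of_mem _ hc
  have hPF : ∀ c ∈ F, ∀ j, (fun i => c.rows i j) ∈ P := fun c hc j => by
    refine Finset.mem_insert_of_mem (Finset.mem_union_right _ ?_)
    exact Finset.mem_biUnion.mpr ⟨c, hc, Finset.mem_image_of_mem _ (Finset.mem_univ j)⟩
  let vr : (Fin k → A) → (L.sum (paramLanguage A)).Term (ι ⊕ Fin P.card) := fun p =>
    Term.var (Sum.inr (num p))
  let l : List ((L.sum (paramLanguage A)).BoundedFormula ι P.card) :=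
    (Finset.univ.toList.map fun j : ι => (Term.var (Sum.inl j)).bdEqual (vr fun i => t i j)) ++
    (C.toList.map fun c => Relations.boundedFormula
      (L := L.sum (paramLanguage A)) (l := P.card) (α := ι) (n := 1)
      (Sum.inr (ParamSymbol.single c)) fun _ => vr fun _ => c) ++
    (F.toList.map fun c => Relations.boundedFormula
      (L := L.sum (paramLanguage A)) (l := P.card) (α := ι) (n := c.arity)
      (Sum.inl c.rel) fun j => vr fun i => c.rows i j)
  have hl : ∀ φ ∈ l, φ.IsAtomic := by
    intro φ hφ
    simp only [l, List.mem_append, List.mem_map] at hφ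
    rcases hφ with (⟨j, -, rfl⟩ | ⟨c, -, rfl⟩) | ⟨c, -, rfl⟩
    · exact .equal _ _
    · exact .rel _ _
    · exact .rel _ _
  have hreal : ∀ (x : ι → A) (y : Fin P.card → A), (∀ φ ∈ l, φ.Realize x y) ↔
      (∀ j, x j = y (num fun i => t i j)) ∧ (∀ c ∈ C, y (num fun _ => c) = c) ∧
      ∀ c ∈ F, RelMap c.rel fun j => y (num fun i => c.rows i j) := by
    intro x y
    have e1 : ∀ j : ι, ((Term.var (Sum.inl j)).bdEqual (vr fun i => t i j)).Realize x y ↔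
        x j = y (num fun i => t i j) := by
      intro j
      rw [BoundedFormula.realize_bdEqual]
      rfl
    have e2 : ∀ c : A, (Relations.boundedFormula
        (L := L.sum (paramLanguage A)) (l := P.card) (α := ι) (n := 1)
        (Sum.inr (ParamSymbol.single c)) fun _ => vr fun _ => c).Realize x y ↔
        y (num fun _ => c) = c := by
      intro c
      exact Iff.rfl
    have e3 : ∀ c : Constraint L A (Fin k), (Relations.boundedFormula
        (L := L.sum (paramLanguage A)) (l := P.card) (α := ι) (n := c.arity)
        (Sum.inl c.rel) fun j => vr fun i => c.rows i j).Realize x y ↔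
        RelMap c.rel fun j => y (num fun i => c.rows i j) := by
      intro c
      exact Iff.rfl
    simp only [l, List.mem_append, List.mem_map, Finset.mem_toList]
    constructor
    · intro h
      refine ⟨fun j => (e1 j).mp (h _ (Or.inl (Or.inl ⟨j, Finset.mem_univ j, rfl⟩))),
        fun c hc => (e2 c).mp (h _ (Or.inl (Or.inr ⟨c, hc, rfl⟩))),
        fun c hc => (e3 c).mp (h _ (Or.inr ⟨c, hc, rfl⟩))⟩
    · rintro ⟨h1, h2, h3⟩ φ ((⟨j, -, rfl⟩ | ⟨c, hc, rfl⟩) | ⟨c, hc, rfl⟩)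
      · exact (e1 j).mpr (h1 j)
      · exact (e2 c).mpr (h2 c hc)
      · exact (e3 c).mpr (h3 c hc)
  have key := ppDefinable_of_atomics (A := A) l hl
  convert key using 1
  ext x
  simp only [Set.mem_ofPred_eq, hreal]
  constructor
  · rintro ⟨f, h1, h2, h3⟩
    have hy : ∀ p ∈ P, f (e.symm (num p)).1 = f p := fun p hp => by rw [hnum p hp]
    refine ⟨fun q => f (e.symm q).1, fun j => ?_, fun c hc => ?_, fun c hc => ?_⟩
    · exact ((hy _ (hPt j)).trans (h1 j)).symm
    · exact (hy _ (hPC c hc)).trans (h2 c hc)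
    · have : (fun j => f (e.symm (num fun i => c.rows i j)).1) = lift f c.rows :=
        funext fun j => hy _ (hPF c hc j)
      rw [this]; exact h3 c hc
  · rintro ⟨y, h1, h2, h3⟩
    exact ⟨fun p => y (num p), fun j => (h1 j).symm, h2, h3⟩

/-- Finitely many elements of `S` represent its orbits under the automorphisms fixing `C`. -/
theorem IsOmegaCategorical.exists_representatives (hcat : IsOmegaCategorical L A)
    {ι : Type u'} [Finite ι] (C : Finset A) (S : Set (ι → A)) :
    ∃ (k : ℕ) (t : Fin k → ι → A), (∀ i, t i ∈ S) ∧
      ∀ x ∈ S, ∃ (i : Fin k) (α : A ≃[L] A), (∀ c ∈ C, α c = c) ∧ ∀ j, α (t i j) = x j := by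
  have := hcat.finite_orbits (ι ⊕ C)
  let q : S → Quotient (tupleSetoid L A (ι ⊕ C)) :=
    fun x => Quotient.mk _ (Sum.elim x.1 fun c => c.1)
  have hfin : Finite (Set.range q) := inferInstance
  obtain ⟨k, ⟨e⟩⟩ := Finite.exists_equiv_fin (Set.range q)
  choose r hr using fun c : Set.range q => c.2
  refine ⟨k, fun i => (r (e.symm i)).1, fun i => (r (e.symm i)).2, fun x hx => ?_⟩
  refine ⟨e ⟨q ⟨x, hx⟩, ⟨_, rfl⟩⟩, ?_⟩
  have h := hr ⟨q ⟨x, hx⟩, ⟨_, rfl⟩⟩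
  obtain ⟨α, hα⟩ := Quotient.exact h
  refine ⟨α, fun c hc => hα (Sum.inr ⟨c, hc⟩), fun j => ?_⟩
  simp only [Equiv.symm_apply_apply]
  exact hα (Sum.inl j)

/-- A relation preserved by all polymorphisms that fix finitely many elements is pp-definable
with parameters. -/
theorem IsInvariant.ppDefinable [Nonempty A] (hcat : IsOmegaCategorical L A)
    {ι : Type u'} [Finite ι] (C : Finset A) {S : Set (ι → A)} (hS : IsInvariant L (C : Set A) S) :
    PPDefinable (L.sum (paramLanguage A)) S := by
  classical
  have := Fintype.ofFinite ι
  have hcount : Countable A := hcat.1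
  obtain ⟨k, t, htS, ht⟩ := hcat.exists_representatives C S
  -- The rows of t represent all orbits of S under the stabilizer of C, so S consists of the tuples
  -- f(t) for polymorphisms f fixing C. It remains to see that finitely many of the constraints
  -- defining such f suffice.
  suffices h : ∃ F : Finset (Constraint L A (Fin k)),
      {x : ι → A | ∃ f : (Fin k → A) → A, (∀ j, lift f t j = x j) ∧ (∀ c ∈ C, (f fun _ => c) = c) ∧
        ∀ c ∈ F, c.Sat f} ⊆ S by
    obtain ⟨F, hF⟩ := h
    have := ppDefinable_of_constraints t C F
    rwa [hF.antisymm fun x hx => ?_] at this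
    obtain ⟨i, α, hαC, hα⟩ := ht x hx
    refine ⟨fun p => α (p i), hα, hαC, fun c _ => ?_⟩
    exact isPoly_iff_sat.mp (isPoly_equiv_comp (f := fun p => p i) α (isPoly_proj i)) c
  by_contra! hcon
  -- Local conditions must be closed under automorphisms, so the values outside S and on C are
  -- prescribed only up to α; composing with the inverse of α removes it afterwards.
  let D : Option (Constraint L A (Fin k)) → Set ((Fin k → A) → A) := fun o => o.elim
    {f | ∃ x, x ∉ S ∧ ∃ α : A ≃[L] A, (∀ j, lift f t j = α (x j)) ∧
      ∀ c ∈ C, (f fun _ => c) = α c} fun c => {f | c.Sat f}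
  suffices hex : ∃ f, ∀ o, f ∈ D o by
    obtain ⟨f, hf⟩ := hex
    obtain ⟨x, hxS, α, hα, hαC⟩ := hf none
    have hpoly : IsPoly L f := isPoly_iff_sat.mpr fun c => hf (some c)
    have := hS (fun p => α.symm (f p)) (isPoly_equiv_comp α.symm hpoly)
      (fun c hc => (congrArg α.symm (hαC c hc)).trans (α.symm_apply_apply c)) t htS
    refine hxS ?_
    convert this using 1
    funext j
    change x j = α.symm (lift f t j)
    rw [hα j]
    exact (α.symm_apply_apply _).symm
  refine exists_mem_of_isLocal hcat D ?_ ?_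
  · rintro (_ | c)
    · refine ⟨(Finset.univ.image fun j i => t i j) ∪ C.image fun c _ => c, ?_⟩
      rintro g g' ⟨β, hβ⟩ ⟨x, hxS, α, hα, hαC⟩
      refine ⟨x, hxS, β.comp α, fun j => ?_, fun c hc => ?_⟩
      · rw [Language.Equiv.comp_apply, ← hα j]
        exact (hβ _ (Finset.mem_union_left _
          (Finset.mem_image_of_mem _ (Finset.mem_univ j)))).symm
      · rw [Language.Equiv.comp_apply, ← hαC c hc]
        exact (hβ _ (Finset.mem_union_right _ (Finset.mem_image_of_mem _ hc))).symm
    · refine ⟨Finset.univ.image fun j i => c.rows i j, ?_⟩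
      rintro g g' ⟨β, hβ⟩ hg
      have : lift g' c.rows = β ∘ lift g c.rows := funext fun j =>
        (hβ _ (Finset.mem_image_of_mem _ (Finset.mem_univ j))).symm
      change RelMap c.rel (lift g' c.rows)
      rw [this]
      exact (β.map_rel c.rel _).mpr hg
  · intro F
    obtain ⟨x, ⟨f, h1, h2, h3⟩, hx⟩ := Set.not_subset.mp (hcon (F.biUnion fun o => o.toFinset))
    refine ⟨f, ?_⟩
    rintro (_ | c) hc
    · exact ⟨x, hx, Language.Equiv.refl L A, h1, h2⟩
    · exact h3 c (Finset.mem_biUnion.mpr ⟨some c, hc, by simp⟩)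

end Definability

/-! ### Projections on two classes of tuples interpret everything -/

section InterpretAll

variable {L : FirstOrder.Language.{v, w}} {A : Type u} [L.Structure A]

/-- The polymorphisms fixing `C` act on two classes of tuples as projections. -/
structure ActsByProjections (L : FirstOrder.Language.{v, w}) {A : Type u} [L.Structure A]
    (C : Set A) {κ : Type*} (Z : Bool → Set (κ → A)) : Prop where
  disjoint : Disjoint (Z false) (Z true)
  nonempty : ∀ b, (Z b).Nonempty
  proj : ∀ {m : ℕ} (f : (Fin m → A) → A), IsPoly L f → Fixes f C →
    ∃ q : Fin m, ∀ (b : Fin m → Bool) (r : Fin m → κ → A), (∀ i, r i ∈ Z (b i)) →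
      lift f r ∈ Z (b q)

theorem ActsByProjections.eq {C : Set A} {κ : Type*} {Z : Bool → Set (κ → A)}
    (hZ : ActsByProjections L C Z) {x : κ → A} {b c : Bool} (hb : x ∈ Z b) (hc : x ∈ Z c) :
    b = c := by
  have := Set.disjoint_left.mp hZ.disjoint
  cases b <;> cases c <;> first | rfl | exact (this hb hc).elim | exact (this hc hb).elim

open Classical in
/-- The tuple `t` encodes the element `b`. -/
def Encodes {κ B : Type*} (Z : Bool → Set (κ → A)) {d : ℕ} (e : Option B × κ ≃ Fin d)
    (t : Fin d → A) (b : B) : Prop :=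
  ∀ o, (fun k => t (e (o, k))) ∈ Z (decide (o = some b))

/-- The partial map that decodes tuples. -/
noncomputable def decode {κ B : Type*} (Z : Bool → Set (κ → A)) {d : ℕ}
    (e : Option B × κ ≃ Fin d) : (Fin d → A) →. B :=
  fun t => ⟨∃ b, Encodes Z e t b, fun h => h.choose⟩

theorem mem_decode {C : Set A} {κ B : Type*} {Z : Bool → Set (κ → A)}
    (hZ : ActsByProjections L C Z) {d : ℕ} {e : Option B × κ ≃ Fin d} {t : Fin d → A} {b : B} :
    b ∈ decode Z e t ↔ Encodes Z e t b := by
  constructor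
  · rintro ⟨h, rfl⟩
    exact h.choose_spec
  · intro h
    have hex : ∃ b, Encodes Z e t b := ⟨b, h⟩
    refine ⟨hex, ?_⟩
    have h1 := hex.choose_spec (some b)
    have := hZ.eq h1 (h (some b))
    simp only [decide_true, decide_eq_true_eq, Option.some.injEq] at this
    exact this.symm

/-- The same coordinate q works for all blocks simultaneously, so codes of b 1, …, b m are sent to a
code of b q, and no property of R is needed. -/
theorem isInvariant_preimageRel {C : Set A} {κ B : Type*} {Z : Bool → Set (κ → A)}
    (hZ : ActsByProjections L C Z) {d : ℕ} (e : Option B × κ ≃ Fin d) {n : ℕ}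
    (R : Set (Fin n → B)) : IsInvariant L C (preimageRel (decode Z e) R) := by
  intro m f hf hfC r hr
  choose b hbR hb using hr
  obtain ⟨q, hq⟩ := hZ.proj f hf hfC
  refine ⟨b q, hbR q, fun j => (mem_decode hZ).mpr fun o => ?_⟩
  exact hq _ (fun i k => r i (j, e (o, k))) fun i => (mem_decode hZ).mp (hb i j) o

theorem ActsByProjections.interpretsAll (hcat : IsOmegaCategorical L A) (C : Finset A)
    {κ : Type*} [Finite κ] [Nonempty κ] {Z : Bool → Set (κ → A)}
    (hZ : ActsByProjections L (C : Set A) Z) : PPInterpretsAllFiniteWithParameters L A := by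
  classical
  intro L' _ B _ _
  -- The extra block `none`, always in `Z false`, keeps d positive even when B is empty.
  obtain ⟨d, ⟨e⟩⟩ := Finite.exists_equiv_fin (Option B × κ)
  obtain ⟨k0⟩ := ‹Nonempty κ›
  have : Nonempty A := ⟨(hZ.nonempty true).choose k0⟩
  have hdef : ∀ {n : ℕ} (R : Set (Fin n → B)),
      PPDefinable (L.sum (paramLanguage A)) (preimageRel (decode Z e) R) := fun R =>
    IsInvariant.ppDefinable hcat C (isInvariant_preimageRel hZ e R)
  refine ⟨d, decode Z e, ⟨(e (none, k0)).pos, fun b => ?_, hdef _, hdef _, fun R => hdef _⟩⟩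
  choose z hz using hZ.nonempty
  refine ⟨fun i => z (decide ((e.symm i).1 = some b)) (e.symm i).2, (mem_decode hZ).mpr fun o => ?_⟩
  simpa using hz (decide (o = some b))

end InterpretAll

/-! ### A cocycle on a minimal graph -/

section Walks

variable {T : Type*}

/-- There is a walk of length `n` from `x` to `y`. -/
def Walk (r : T → T → Prop) : ℕ → T → T → Prop
  | 0, x, y => x = y
  | n + 1, x, y => ∃ z, Walk r n x z ∧ r z y

theorem Walk.append {r : T → T → Prop} {m n : ℕ} {x y z : T} (h : Walk r m x y)
    (k : Walk r n y z) : Walk r (m + n) x z := by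
  induction n generalizing z with
  | zero => cases k; exact h
  | succ n ih =>
    obtain ⟨t, h1, h2⟩ := k
    exact ⟨t, ih h1, h2⟩

theorem walk_one {r : T → T → Prop} {x y : T} (h : r x y) : Walk r 1 x y := ⟨x, rfl, h⟩

theorem Walk.symm {r : T → T → Prop} (hr : ∀ x y, r x y → r y x) {n : ℕ} {x y : T}
    (h : Walk r n x y) : Walk r n y x := by
  induction n generalizing y with
  | zero => exact (show x = y from h).symm
  | succ n ih =>
    obtain ⟨z, h1, h2⟩ := h
    have := (walk_one (hr _ _ h2)).append (ih h1)
    rwa [Nat.add_comm] at this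

/-- The elements adjacent to some element of `U`. -/
def nbr (H : T → T → Prop) (U : Set T) : Set T := {x | ∃ y ∈ U, H x y}

/-- The graph induced on `U`. -/
def induced (H : T → T → Prop) (U : Set T) (x y : T) : Prop := H x y ∧ x ∈ U ∧ y ∈ U

/-- The vertices that can be reached from `s` by a walk of even length. -/
def side (r : T → T → Prop) (s : T) : Set T := ⋃ n : ℕ, {x | Walk r (2 * n) s x}

/-- The square condition for a function on the arcs of a graph: it is a cocycle on the complex
that is obtained by filling all closed walks of length four in the bipartite double. -/
def IsHeight (H : T → T → Prop) (h : T → T → ℤ) : Prop :=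
  ∀ x y x' y', H x y → H y x' → H x' y' → H y' x → h x y - h x' y + h x' y' - h x y' = 0

variable {H : T → T → Prop} {U₀ : Set T} {I : Set (Set T)}

/-- The hypotheses on a finite graph with a family of distinguished sets of vertices that hold in
a minimal counterexample. -/
structure MinimalGraph (H : T → T → Prop) (U₀ : Set T) (I : Set (Set T)) : Prop where
  symm : ∀ x y, H x y → H y x
  irrefl : ∀ x, ¬ H x x
  left_mem : ∀ x y, H x y → x ∈ U₀
  singleton : ∀ p ∈ U₀, {p} ∈ I
  inter : ∀ U ∈ I, ∀ V ∈ I, U ∩ V ∈ I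
  nbr : ∀ U ∈ I, nbr H U ∈ I
  union : ∀ s : ℕ → Set T, Monotone s → (∀ n, s n ∈ I) → (⋃ n, s n) ∈ I
  minimal : ∀ U ∈ I, U ⊆ U₀ → U ≠ U₀ → ∀ n x, Odd n → ¬ Walk (induced H U) n x x

namespace MinimalGraph

variable (hG : MinimalGraph H U₀ I)

include hG

theorem nbr_subset (U : Set T) : PseudoloopConditions.nbr H U ⊆ U₀ :=
  fun _ ⟨_, _, h⟩ => hG.left_mem _ _ h

theorem eq_of_triangle {U : Set T} (hU : U ∈ I) (hU₀ : U ⊆ U₀) {p a b : T} (hp : p ∈ U)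
    (ha : a ∈ U) (hb : b ∈ U) (hpa : H p a) (hab : H a b) (hbp : H b p) : U = U₀ := by
  by_contra hne
  refine hG.minimal U hU hU₀ hne 3 p (by decide) ?_
  exact ⟨b, ⟨a, ⟨p, rfl, hpa, hp, ha⟩, hab, ha, hb⟩, hbp, hb, hp⟩

theorem nbr_nbr_of_triangle {p a b : T} (hpa : H p a) (hab : H a b) (hbp : H b p) :
    PseudoloopConditions.nbr H (PseudoloopConditions.nbr H {p}) = U₀ := by
  refine hG.eq_of_triangle (hG.nbr _ (hG.nbr _ (hG.singleton p (hG.left_mem _ _ hpa))))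
    (hG.nbr_subset _) (p := p) (a := a) (b := b) ?_ ?_ ?_ hpa hab hbp
  · exact ⟨a, ⟨p, rfl, hG.symm _ _ hpa⟩, hpa⟩
  · exact ⟨b, ⟨p, rfl, hbp⟩, hab⟩
  · exact ⟨a, ⟨p, rfl, hG.symm _ _ hpa⟩, hG.symm _ _ hab⟩

/-- Any two vertices have a common neighbour. -/
theorem exists_common {p a b : T} (hpa : H p a) (hab : H a b) (hbp : H b p) {x y : T}
    (hx : x ∈ U₀) (hy : y ∈ U₀) : ∃ c, H x c ∧ H c y := by
  -- The second neighbourhood of a vertex of a triangle is everything, so y is joined to each vertex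
  -- of the triangle by a walk of length two. Hence the second neighbourhood of y contains the
  -- triangle, and it is everything too.
  have key : ∀ {q r s : T}, H q r → H r s → H s q →
      q ∈ PseudoloopConditions.nbr H (PseudoloopConditions.nbr H {y}) := by
    intro q r s hqr hrs hsq
    have h := hG.nbr_nbr_of_triangle hqr hrs hsq
    rw [← h] at hy
    obtain ⟨c, ⟨_, rfl, hc⟩, hyc⟩ := hy
    exact ⟨c, ⟨y, rfl, hG.symm _ _ hyc⟩, hG.symm _ _ hc⟩
  have h := hG.eq_of_triangle (hG.nbr _ (hG.nbr _ (hG.singleton y hy)))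
    (hG.nbr_subset _) (key hpa hab hbp) (key hab hbp hpa) (key hbp hpa hab) hpa hab hbp
  rw [← h] at hx
  obtain ⟨c, ⟨_, rfl, hc⟩, hxc⟩ := hx
  exact ⟨c, hxc, hc⟩

theorem walk_mem {V : Set T} (hV : V ∈ I) {s : T} (hs : s ∈ U₀) (n : ℕ) :
    {x | Walk (induced H V) n s x} ∈ I := by
  induction n with
  | zero =>
    convert hG.singleton s hs using 1
    ext x
    exact eq_comm
  | succ n ih =>
    convert hG.inter _ (hG.nbr _ (hG.inter _ ih V hV)) V hV using 1
    ext x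
    constructor
    · rintro ⟨z, h1, h2, h3, h4⟩
      exact ⟨⟨z, ⟨h1, h3⟩, hG.symm _ _ h2⟩, h4⟩
    · rintro ⟨⟨z, ⟨h1, h3⟩, h2⟩, h4⟩
      exact ⟨z, h1, hG.symm _ _ h2, h3, h4⟩

/-- A minimal graph with a triangle carries a height function that does not vanish on the walk
that runs twice through some triangle. -/
theorem exists_isHeight [Finite T] (htri : ∃ p a b, H p a ∧ H a b ∧ H b p) :
    ∃ h : T → T → ℤ, IsHeight H h ∧ ∃ p a b, H p a ∧ H a b ∧ H b p ∧
      h p a - h b a + h b p - h a p + h a b - h p b = 1 := by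
  classical
  obtain ⟨p, a, b, hpa, hab, hbp⟩ := htri
  have common := fun {x y : T} => hG.exists_common hpa hab hbp (x := x) (y := y)
  have hpU := hG.left_mem _ _ hpa
  -- F is a maximal distinguished set whose neighbourhood V is not all of U₀; {p} is a legitimate
  -- start since p is not its own neighbour. By minimality V contains no odd closed walk.
  obtain ⟨F, hpF', ⟨hFI, hFU, hFN⟩, hFmax⟩ := Set.Finite.exists_le_maximal
    (s := {F | F ∈ I ∧ F ⊆ U₀ ∧ PseudoloopConditions.nbr H F ≠ U₀}) (Set.toFinite _) (a := {p})
    ⟨hG.singleton p hpU, by simpa using hpU, fun h => by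
      rw [← h] at hpU
      obtain ⟨_, rfl, hpp⟩ := hpU
      exact hG.irrefl _ hpp⟩
  have hpF : p ∈ F := hpF' rfl
  set V := PseudoloopConditions.nbr H F with hVdef
  have hVI : V ∈ I := hG.nbr F hFI
  have hVU : V ⊆ U₀ := hG.nbr_subset F
  have noodd := hG.minimal V hVI hVU hFN
  have rsymm : ∀ x y, induced H V x y → induced H V y x :=
    fun x y h => ⟨hG.symm _ _ h.1, h.2.2, h.2.1⟩
  have hL1 : ∀ f ∈ F, ∀ s ∈ V, ∃ x ∈ V, H f x ∧ H x s := by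
    intro f hf s hs
    obtain ⟨c, h1, h2⟩ := common (hFU hf) (hVU hs)
    exact ⟨c, ⟨f, hf, hG.symm _ _ h1⟩, h1, h2⟩
  have hFV : ∀ f ∈ F, f ∉ V := by
    rintro f hf ⟨f', hf', hff'⟩
    have hfV : f ∈ V := ⟨f', hf', hff'⟩
    have hfV' : f' ∈ V := ⟨f, hf, hG.symm _ _ hff'⟩
    obtain ⟨c, hc, h1, h2⟩ := hL1 f hf f' hfV'
    refine noodd 3 f (by decide) ⟨f', ⟨c, ⟨f, rfl, h1, hfV, hc⟩, h2, hc, hfV'⟩,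
      hG.symm _ _ hff', hfV', hfV⟩
  have hWV : ∀ {s : T}, s ∈ V → ∀ {n x}, Walk (induced H V) n s x → x ∈ V := by
    intro s hs n x hw
    cases n with
    | zero => exact (show s = x from hw) ▸ hs
    | succ n => obtain ⟨z, -, h⟩ := hw; exact h.2.2
  have hmono : ∀ {s : T}, s ∈ V → Monotone fun n : ℕ => {x | Walk (induced H V) (2 * n) s x} := by
    intro s hs
    refine monotone_nat_of_le_succ fun n x hx => ?_
    have hxV := hWV hs hx
    obtain ⟨f, hf, hxf⟩ := id hxV
    obtain ⟨c, hc, -, hcx⟩ := hL1 f hf x hxV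
    exact ⟨c, ⟨x, hx, hG.symm _ _ hcx, hxV, hc⟩, hcx, hc, hxV⟩
  have hsI : ∀ {s : T}, s ∈ V → side (induced H V) s ∈ I := fun {s} hs =>
    hG.union _ (hmono hs) fun n => hG.walk_mem hVI (hVU hs) _
  have hsself : ∀ s : T, s ∈ side (induced H V) s := fun s => Set.mem_iUnion.mpr ⟨0, rfl⟩
  have hsV : ∀ {s : T}, s ∈ V → side (induced H V) s ⊆ V := by
    intro s hs x hx
    obtain ⟨n, hn⟩ := Set.mem_iUnion.mp hx
    exact hWV hs hn
  have hL2 : ∀ f ∈ F, ∀ s ∈ V, f ∈ PseudoloopConditions.nbr H (side (induced H V) s) := by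
    intro f hf s hs
    obtain ⟨x, hx, hfx, hxs⟩ := hL1 f hf s hs
    obtain ⟨y, hy, hfy, hyx⟩ := hL1 f hf x hx
    refine ⟨y, Set.mem_iUnion.mpr ⟨1, ?_⟩, hfy⟩
    exact ⟨x, ⟨s, rfl, hG.symm _ _ hxs, hs, hx⟩, hG.symm _ _ hyx, hx, hy⟩
  have haV : a ∈ V := ⟨p, hpF, hG.symm _ _ hpa⟩
  -- If a vertex outside F has neighbours y, y' in V, then they lie on the same side. The set F' of
  -- common neighbours of the two sides contains F and x, so by maximality its neighbourhood is
  -- everything. In particular p has a neighbour v in F'; it lies in V and links the side of a to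
  -- that of y'.
  have hP : ∀ x ∉ F, ∀ y ∈ V, ∀ y' ∈ V, H x y → H x y' → y ∈ side (induced H V) a →
      y' ∈ side (induced H V) a := by
    intro x hx y hy y' hy' hxy hxy' hya
    set F' := PseudoloopConditions.nbr H (side (induced H V) a) ∩
      PseudoloopConditions.nbr H (side (induced H V) y') with hF'
    have hF'I : F' ∈ I := hG.inter _ (hG.nbr _ (hsI haV)) _ (hG.nbr _ (hsI hy'))
    have hFF' : F ⊆ F' := fun f hf => ⟨hL2 f hf a haV, hL2 f hf y' hy'⟩
    have hxF' : x ∈ F' := ⟨⟨y, hya, hxy⟩, ⟨y', hsself y', hxy'⟩⟩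
    have hbig : PseudoloopConditions.nbr H F' = U₀ := by
      by_contra hne
      exact hx (hFmax ⟨hF'I, Set.inter_subset_left.trans (hG.nbr_subset _), hne⟩ hFF' hxF')
    have hpU' := hpU
    rw [← hbig] at hpU'
    obtain ⟨v, ⟨⟨s₁, hs₁, hvs₁⟩, ⟨s₂, hs₂, hvs₂⟩⟩, hpv⟩ := hpU'
    have hvV : v ∈ V := ⟨p, hpF, hG.symm _ _ hpv⟩
    have hs₁V := hsV haV hs₁
    have hs₂V := hsV hy' hs₂
    obtain ⟨m, hm⟩ := Set.mem_iUnion.mp hs₁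
    obtain ⟨n, hn⟩ := Set.mem_iUnion.mp hs₂
    refine Set.mem_iUnion.mpr ⟨m + 1 + n, ?_⟩
    have h2 : Walk (induced H V) 2 s₁ s₂ :=
      ⟨v, ⟨s₁, rfl, hG.symm _ _ hvs₁, hs₁V, hvV⟩, hvs₂, hvV, hs₂V⟩
    have hn' : Walk (induced H V) (2 * n) y' s₂ := hn
    have hm' : Walk (induced H V) (2 * m) a s₁ := hm
    have := (hm'.append h2).append (hn'.symm rsymm)
    have e : 2 * m + 2 + 2 * n = 2 * (m + 1 + n) := by ring
    rw [e] at this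
    exact this
  obtain ⟨c, hc, hpc, hca⟩ := hL1 p hpF a haV
  have hcs : c ∉ side (induced H V) a := by
    intro h
    obtain ⟨n, hn⟩ := Set.mem_iUnion.mp h
    have hn' : Walk (induced H V) (2 * n) a c := hn
    exact noodd (2 * n + 1) a ⟨n, rfl⟩ (hn'.append (walk_one ⟨hca, hc, haV⟩))
  have hcF : c ∉ F := fun h => hFV c h hc
  have haF : a ∉ F := fun h => hFV a h haV
  -- The cocycle counts the arcs from F to the side of a. In a square with just one of x, x' in F,
  -- the vertices y, y' are in V and by `hP` on the same side, so the terms cancel. On the triangle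
  -- p, a, c only the arc from p to a counts, since a and c are outside F and c is not on the side
  -- of a.
  refine ⟨fun z y => if z ∈ F ∧ y ∈ side (induced H V) a then 1 else 0, ?_, p, a, c, hpa,
    hG.symm _ _ hca, hG.symm _ _ hpc, ?_⟩
  · intro x y x' y' hxy hyx' hx'y' hy'x
    by_cases hx : x ∈ F <;> by_cases hx' : x' ∈ F
    · simp only [hx, hx', true_and]; ring
    · have hy : y ∈ V := ⟨x, hx, hG.symm _ _ hxy⟩
      have hy' : y' ∈ V := ⟨x, hx, hy'x⟩
      have := hP x' hx' y hy y' hy' (hG.symm _ _ hyx') hx'y'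
      have := hP x' hx' y' hy' y hy hx'y' (hG.symm _ _ hyx')
      have hiff : y ∈ side (induced H V) a ↔ y' ∈ side (induced H V) a := ⟨by assumption, this⟩
      simp [hx, hx', hiff]
    · have hy : y ∈ V := ⟨x', hx', hyx'⟩
      have hy' : y' ∈ V := ⟨x', hx', hG.symm _ _ hx'y'⟩
      have := hP x hx y hy y' hy' hxy (hG.symm _ _ hy'x)
      have := hP x hx y' hy' y hy (hG.symm _ _ hy'x) hxy
      have hiff : y ∈ side (induced H V) a ↔ y' ∈ side (induced H V) a := ⟨by assumption, this⟩
      simp [hx, hx', hiff]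
    · simp [hx, hx']
  · simp [hpF, hcF, haF, hcs, hsself a]

end MinimalGraph

end Walks

/-! ### Heights of closed walks and of their products -/

section Height

variable {X : Type*} (G : X → X → Prop) (h : X → X → ℤ)

/-- The value of a height function on the `i`-th step of a walk. -/
def arc (i : ℕ) (x y : X) : ℤ := if Even i then h x y else -h y x

/-- The height of the first `P` steps of a walk that starts at a time of the parity of `ε`. -/
def walkHeight (P : ℕ) (γ : ℕ → X) (ε : ℕ) : ℤ :=
  ∑ i ∈ Finset.range P, arc h (i + ε) (γ i) (γ (i + 1))

/-- The walk that alternates between `x` and `y`. -/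
def alternate (x y : X) (i : ℕ) : X := if Even i then x else y

/-- A closed walk of length `P` at `w`, continued periodically. -/
structure IsLoop (w : X) (P : ℕ) (γ : ℕ → X) : Prop where
  start : γ 0 = w
  adj : ∀ i, G (γ i) (γ (i + 1))
  period : ∀ i, γ (i + P) = γ i

variable {G h}

theorem arc_add_even {i n : ℕ} (hn : Even n) (x y : X) : arc h (i + n) x y = arc h i x y := by
  simp only [arc, Nat.even_add, hn, iff_true]

theorem arc_reverse (i : ℕ) (x y : X) : arc h (i + 1) y x = -arc h i x y := by
  by_cases hi : Even i <;> simp [arc, Nat.even_add_one, hi]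

/-- Even and odd steps run in opposite directions between the two halves of the bipartite double,
hence the sign in `arc`; both parities reduce to the cocycle condition. -/
theorem arc_square (hh : IsHeight G h) (hs : ∀ x y, G x y → G y x) (i : ℕ) {x y z t : X}
    (hxy : G x y) (hyz : G y z) (hxt : G x t) (htz : G t z) :
    arc h i x y + arc h (i + 1) y z = arc h i x t + arc h (i + 1) t z := by
  by_cases hi : Even i
  · have := hh x y z t hxy hyz (hs _ _ htz) (hs _ _ hxt)
    simp only [arc, hi, if_true, Nat.even_add_one, not_true, if_false]
    linarith
  · have := hh y x t z (hs _ _ hxy) hxt htz (hs _ _ hyz)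
    simp only [arc, hi, if_false, Nat.even_add_one, not_false_iff, if_true]
    linarith

/-- Two closed walks that are adjacent at every time have the same height. -/
theorem walkHeight_eq_of_adj (hh : IsHeight G h) (hs : ∀ x y, G x y → G y x) {P : ℕ}
    (hP : Even P) {γ γ' : ℕ → X} (hγ : ∀ i, G (γ i) (γ (i + 1)))
    (hγ' : ∀ i, G (γ' i) (γ' (i + 1))) (hadj : ∀ i, G (γ i) (γ' i)) (h0 : γ P = γ 0)
    (h0' : γ' P = γ' 0) (ε : ℕ) : walkHeight h P γ ε = walkHeight h P γ' (ε + 1) := by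
  -- The strip between the two walks is filled with squares. Summing over them leaves the rungs at
  -- times 0 and n, which agree when n = P.
  have hstep : ∀ n : ℕ, walkHeight h n γ ε + arc h (n + ε) (γ n) (γ' n) =
      arc h (0 + ε) (γ 0) (γ' 0) + walkHeight h n γ' (ε + 1) := by
    intro n
    induction n with
    | zero => simp [walkHeight]
    | succ n ih =>
      have := arc_square hh hs (n + ε) (hγ n) (hadj (n + 1)) (hadj n) (hγ' n)
      simp only [walkHeight, Finset.sum_range_succ] at ih ⊢
      rw [show n + 1 + ε = n + ε + 1 by ring, show n + (ε + 1) = n + ε + 1 by ring]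
      linarith
  have := hstep P
  rw [h0, h0', Nat.add_comm P ε, arc_add_even hP, Nat.zero_add] at this
  linarith

theorem sum_range_shift {P : ℕ} {g : ℕ → ℤ} (hg : g P = g 0) :
    ∑ i ∈ Finset.range P, g (i + 1) = ∑ i ∈ Finset.range P, g i := by
  have h1 := Finset.sum_range_succ g P
  have h2 := Finset.sum_range_succ' g P
  linarith

theorem walkHeight_shift {P : ℕ} (hP : Even P) {γ : ℕ → X} (hγ : ∀ i, γ (i + P) = γ i) (ε : ℕ) :
    walkHeight h P (fun i => γ (i + 1)) (ε + 1) = walkHeight h P γ ε := by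
  have h0 : γ P = γ 0 := by simpa using hγ 0
  have h1 : γ (P + 1) = γ 1 := by simpa [Nat.add_comm] using hγ 1
  have hg : arc h (P + ε) (γ P) (γ (P + 1)) = arc h (0 + ε) (γ 0) (γ (0 + 1)) := by
    rw [h0, h1, Nat.add_comm P ε, arc_add_even hP, Nat.zero_add]
  rw [walkHeight, walkHeight, ← sum_range_shift (g := fun i => arc h (i + ε) (γ i) (γ (i + 1))) hg]
  refine Finset.sum_congr rfl fun i _ => ?_
  rw [show i + (ε + 1) = i + 1 + ε by ring]

theorem walkHeight_add {P : ℕ} (hP : Even P) {γ γ₁ γ₂ : ℕ → X} (h₁ : ∀ i ≤ P, γ i = γ₁ i)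
    (h₂ : ∀ i ≤ P, γ (P + i) = γ₂ i) :
    walkHeight h (P + P) γ 0 = walkHeight h P γ₁ 0 + walkHeight h P γ₂ 0 := by
  rw [walkHeight, Finset.sum_range_add]
  congr 1
  · refine Finset.sum_congr rfl fun i hi => ?_
    have := Finset.mem_range.mp hi
    rw [h₁ i (by omega), h₁ (i + 1) (by omega)]
  · refine Finset.sum_congr rfl fun i hi => ?_
    have := Finset.mem_range.mp hi
    rw [h₂ i (by omega), show γ (P + i + 1) = γ₂ (i + 1) from h₂ (i + 1) (by omega),
      show P + i + 0 = i + 0 + P by ring, arc_add_even hP]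

theorem alternate_add {P : ℕ} (hP : Even P) (x y : X) (i : ℕ) :
    alternate x y (i + P) = alternate x y i := by
  simp only [alternate, Nat.even_add, hP, iff_true]

theorem isLoop_alternate (hs : ∀ x y, G x y → G y x) {P : ℕ} (hP : Even P) {x y : X}
    (hxy : G x y) : IsLoop G x P (alternate x y) where
  start := by simp [alternate]
  adj i := by
    by_cases hi : Even i
    · simpa [alternate, hi, Nat.even_add_one] using hxy
    · simpa [alternate, hi, Nat.even_add_one] using hs _ _ hxy
  period := alternate_add hP x y

theorem walkHeight_alternate {P : ℕ} (hP : Even P) (x y : X) :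
    walkHeight h P (alternate x y) 0 = 0 := by
  obtain ⟨n, rfl⟩ := hP
  have : ∀ n, walkHeight h (2 * n) (alternate x y) 0 = 0 := by
    intro n
    induction n with
    | zero => simp [walkHeight]
    | succ n ih =>
      rw [walkHeight] at ih ⊢
      rw [show 2 * (n + 1) = 2 * n + 1 + 1 by ring, Finset.sum_range_succ, Finset.sum_range_succ,
        ih]
      simp [arc, alternate, Nat.even_add_one]
  rw [← two_mul]
  exact this n

/-- A closed walk followed by a walk that alternates between its base point and a neighbour. -/
def pad (P : ℕ) (w γ : ℕ → X) (i : ℕ) : X := if i % (P + P) < P then γ i else w i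

theorem IsLoop.eq_of_mod {w : X} {P : ℕ} {γ : ℕ → X} (hγ : IsLoop G w P γ) (n i : ℕ) :
    γ (i + n * P) = γ i := by
  induction n with
  | zero => simp
  | succ n ih => rw [Nat.succ_mul, ← Nat.add_assoc, hγ.period, ih]

theorem IsLoop.mod {w : X} {P : ℕ} {γ : ℕ → X} (hγ : IsLoop G w P γ) (i : ℕ) :
    γ (i % P) = γ i := by
  conv_rhs => rw [← Nat.mod_add_div i P, Nat.mul_comm]
  exact (hγ.eq_of_mod _ _).symm

theorem pad_of_le {x : X} {P : ℕ} {w γ : ℕ → X} (hw : IsLoop G x P w) (hγ : IsLoop G x P γ)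
    {i : ℕ} (hi : i ≤ P) : pad P w γ i = γ i := by
  rcases Nat.lt_or_ge i P with h | h
  · rw [pad, Nat.mod_eq_of_lt (by omega), if_pos h]
  · obtain rfl : i = P := le_antisymm hi h
    have h1 : w i = x := by have := hw.period 0; rw [Nat.zero_add] at this; rw [this, hw.start]
    have h2 : γ i = x := by have := hγ.period 0; rw [Nat.zero_add] at this; rw [this, hγ.start]
    rw [pad, h1, h2, ite_self]

theorem pad_period {x : X} {P : ℕ} {w γ : ℕ → X} (hw : IsLoop G x P w) (hγ : IsLoop G x P γ)
    (i : ℕ) : pad P w γ (i + (P + P)) = pad P w γ i := by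
  rw [pad, pad, Nat.add_mod_right, ← Nat.add_assoc, hw.period, hw.period, hγ.period, hγ.period]

theorem pad_add_of_le {x : X} {P : ℕ} {w γ : ℕ → X} (hw : IsLoop G x P w) (hγ : IsLoop G x P γ)
    {i : ℕ} (hi : i ≤ P) : pad P w γ (P + i) = w i := by
  rcases Nat.lt_or_ge i P with h | h
  · rw [pad, Nat.mod_eq_of_lt (by omega), if_neg (by omega), Nat.add_comm, hw.period]
  · obtain rfl : i = P := le_antisymm hi h
    have := pad_period hw hγ 0
    rw [Nat.zero_add] at this
    have h1 := hw.period 0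
    rw [Nat.zero_add] at h1
    rw [this, pad_of_le hw hγ (Nat.zero_le _), hγ.start, h1, hw.start]

theorem pad_isLoop {x : X} {P : ℕ} (hP0 : 0 < P) {w γ : ℕ → X} (hw : IsLoop G x P w)
    (hγ : IsLoop G x P γ) : IsLoop G x (P + P) (pad P w γ) where
  start := by rw [pad_of_le hw hγ (Nat.zero_le _), hγ.start]
  period := pad_period hw hγ
  adj i := by
    have hper : ∀ n i, pad P w γ (i + n * (P + P)) = pad P w γ i := by
      intro n i
      induction n with
      | zero => simp
      | succ n ih => rw [Nat.succ_mul, ← Nat.add_assoc, pad_period hw hγ, ih]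
    have hlt := Nat.mod_lt i (show 0 < P + P by omega)
    have e : i = i % (P + P) + i / (P + P) * (P + P) := by
      rw [Nat.mul_comm]; exact (Nat.mod_add_div i (P + P)).symm
    have e1 : pad P w γ i = pad P w γ (i % (P + P)) := by
      conv_lhs => rw [e]
      exact hper _ _
    have e2 : pad P w γ (i + 1) = pad P w γ (i % (P + P) + 1) := by
      conv_lhs => rw [e]
      rw [Nat.add_right_comm]
      exact hper _ _
    rw [e1, e2]
    rcases Nat.lt_or_ge (i % (P + P)) P with h | h
    · rw [pad_of_le hw hγ h.le, pad_of_le hw hγ h]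
      exact hγ.adj _
    · obtain ⟨t, ht⟩ := Nat.exists_eq_add_of_le h
      rw [ht, Nat.add_assoc, pad_add_of_le hw hγ (by omega), pad_add_of_le hw hγ (by omega)]
      exact hw.adj _

variable {Y Z : Type*} {GY : Y → Y → Prop} {GZ : Z → Z → Prop}

/-- The height of a product of two closed walks does not change when one of them is delayed by
two steps. -/
theorem walkHeight_delay (hh : IsHeight G h) (hs : ∀ x y, G x y → G y x)
    (hsZ : ∀ x y, GZ x y → GZ y x) {F : ℕ → Y → Z → X}
    (hF : ∀ i y y' z z', GY y y' → GZ z z' → G (F i y z) (F (i + 1) y' z'))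
    (hF2 : ∀ i y z, F (i + 2) y z = F i y z) {P : ℕ} (hP : Even P) {y : Y} {z : Z}
    {a : ℕ → Y} {b : ℕ → Z} (ha : IsLoop GY y P a) (hb : IsLoop GZ z P b) (t : ℕ) :
    walkHeight h P (fun i => F i (a i) (b (i + (t + 2)))) 0 =
      walkHeight h P (fun i => F i (a i) (b (i + t))) 0 := by
  have hFP : ∀ i y z, F (i + P) y z = F i y z := by
    obtain ⟨n, rfl⟩ := hP
    clear ha hb
    intro i y z
    induction n with
    | zero => rfl
    | succ n ih => rw [show i + (n + 1 + (n + 1)) = i + (n + n) + 2 by ring, hF2, ih]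
  have hper : ∀ t i, F (i + P) (a (i + P)) (b (i + P + t)) = F i (a i) (b (i + t)) := by
    intro t i
    rw [hFP, ha.period, Nat.add_right_comm, hb.period]
  have hadj : ∀ t i, G (F i (a i) (b (i + t))) (F (i + 1) (a (i + 1)) (b (i + 1 + t))) := by
    intro t i
    refine hF _ _ _ _ _ (ha.adj i) ?_
    rw [Nat.add_right_comm]
    exact hb.adj _
  -- At time i the walk delayed by two more steps is adjacent to the other walk at time i + 1,
  -- because b (i + t + 2) and b (i + t + 1) are neighbours.
  rw [← walkHeight_shift (γ := fun i => F i (a i) (b (i + t))) hP (hper t)]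
  refine walkHeight_eq_of_adj hh hs hP (hadj (t + 2)) (fun i => hadj t (i + 1)) (fun i => ?_) ?_
    ?_ 0
  · refine hF _ _ _ _ _ (ha.adj i) (hsZ _ _ ?_)
    rw [show i + (t + 2) = i + 1 + t + 1 by ring]
    exact hb.adj _
  · simpa using hper (t + 2) 0
  · have := hper t 1
    simpa [Nat.add_comm] using this

/-- The height of a product of two closed walks is the sum of the heights of the walks where one
factor alternates between the base point and a neighbour. -/
theorem walkHeight_product (hh : IsHeight G h) (hs : ∀ x y, G x y → G y x)
    (hsY : ∀ x y, GY x y → GY y x) (hsZ : ∀ x y, GZ x y → GZ y x) {F : ℕ → Y → Z → X}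
    (hF : ∀ i y y' z z', GY y y' → GZ z z' → G (F i y z) (F (i + 1) y' z'))
    (hF2 : ∀ i y z, F (i + 2) y z = F i y z) {P : ℕ} (hP : Even P) (hP0 : 0 < P)
    {y y₁ : Y} {z z₁ : Z} (hy : GY y y₁) (hz : GZ z z₁)
    {a : ℕ → Y} {b : ℕ → Z} (ha : IsLoop GY y P a) (hb : IsLoop GZ z P b) :
    walkHeight h P (fun i => F i (a i) (b i)) 0 =
      walkHeight h P (fun i => F i (a i) (alternate z z₁ i)) 0 +
        walkHeight h P (fun i => F i (alternate y y₁ i) (b i)) 0 := by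
  have hFP : ∀ i y z, F (P + i) y z = F i y z := by
    obtain ⟨n, rfl⟩ := hP
    clear hP0 ha hb
    intro i y z
    induction n with
    | zero => rw [Nat.add_zero, Nat.zero_add]
    | succ n ih => rw [show n + 1 + (n + 1) + i = n + n + i + 2 by ring, hF2, ih]
  have hy' := isLoop_alternate hsY hP hy
  have hz' := isLoop_alternate hsZ hP hz
  have hpa := pad_isLoop hP0 hy' ha
  have hpb := pad_isLoop hP0 hz' hb
  -- The Eckmann–Hilton argument: each loop is followed by an idle, alternating one. Delaying the
  -- second factor by P steps, two at a time, turns (a, b) followed by (idle, idle) into (a, idle)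
  -- followed by (idle, b).
  have hdelay : ∀ n : ℕ, walkHeight h (P + P) (fun i => F i (pad P (alternate y y₁) a i)
      (pad P (alternate z z₁) b (i + 2 * n))) 0 =
      walkHeight h (P + P) (fun i => F i (pad P (alternate y y₁) a i)
      (pad P (alternate z z₁) b i)) 0 := by
    intro n
    induction n with
    | zero => rfl
    | succ n ih =>
      rw [← ih]
      exact walkHeight_delay hh hs hsZ hF hF2 (hP.add hP) hpa hpb (2 * n)
  obtain ⟨n, hn⟩ := id hP
  have h1 := hdelay n
  rw [walkHeight_add hP (γ₁ := fun i => F i (a i) (alternate z z₁ i))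
      (γ₂ := fun i => F i (alternate y y₁ i) (b i)),
    walkHeight_add hP (γ₁ := fun i => F i (a i) (b i))
      (γ₂ := alternate (F 0 y z) (F 1 y₁ z₁)), walkHeight_alternate hP, add_zero] at h1
  · exact h1.symm
  · intro i hi
    rw [pad_of_le hy' ha hi, pad_of_le hz' hb hi]
  · intro i hi
    rw [pad_add_of_le hy' ha hi, pad_add_of_le hz' hb hi, hFP]
    have hF' : ∀ j y z, F (2 * j) y z = F 0 y z ∧ F (2 * j + 1) y z = F 1 y z := by
      intro j y z
      induction j with
      | zero => exact ⟨rfl, rfl⟩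
      | succ j ih =>
        exact ⟨(hF2 (2 * j) y z).trans ih.1, (hF2 (2 * j + 1) y z).trans ih.2⟩
    obtain ⟨j, rfl | rfl⟩ := i.even_or_odd'
    · simp [alternate, (hF' j _ _).1]
    · simp [alternate, (hF' j _ _).2]
  · intro i hi
    rw [pad_of_le hy' ha hi, show i + 2 * n = P + i by omega, pad_add_of_le hz' hb hi]
  · intro i hi
    rw [pad_add_of_le hy' ha hi, show P + i + 2 * n = i + (P + P) by omega, pad_period hz' hb,
      pad_of_le hz' hb hi, hFP]

end Height

/-! ### The action of binary polymorphisms on height vectors -/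

section Degree

variable {L : FirstOrder.Language.{v, w}} {A : Type u} [L.Structure A]

/-- Binary polymorphisms that fix the elements of `C`. -/
structure BinaryPoly (L : FirstOrder.Language.{v, w}) {A : Type u} [L.Structure A]
    (C : Set A) where
  toFun : A → A → A
  isPoly : IsPoly L fun v : Fin 2 → A => toFun (v 0) (v 1)
  idem : ∀ c ∈ C, toFun c c = c

namespace BinaryPoly

variable {C : Set A}

/-- The first projection. -/
def fst : BinaryPoly L C := ⟨fun x _ => x, isPoly_proj 0, fun _ _ => rfl⟩

/-- The second projection. -/
def snd : BinaryPoly L C := ⟨fun _ y => y, isPoly_proj 1, fun _ _ => rfl⟩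

/-- Composition of binary operations. -/
def subst (f g k : BinaryPoly L C) : BinaryPoly L C where
  toFun x y := f.toFun (g.toFun x y) (k.toFun x y)
  isPoly R r h := f.isPoly R
    (fun i => if i = 0 then fun j => g.toFun (r 0 j) (r 1 j) else fun j => k.toFun (r 0 j) (r 1 j))
    fun i => by
      by_cases hi : i = 0
      · simpa only [hi, if_true] using g.isPoly R r h
      · simpa only [hi, if_false] using k.isPoly R r h
  idem c hc := by rw [g.idem c hc, k.idem c hc, f.idem c hc]

/-- The binary minor of an operation that identifies the variables in `S` with each other and
the remaining variables with each other. -/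
def minor {m : ℕ} (f : (Fin m → A) → A) (hf : IsPoly L f) (hfC : Fixes f C) (S : Fin m → Bool) :
    BinaryPoly L C where
  toFun x y := f fun i => if S i then x else y
  isPoly R r h := hf R (fun i => if S i then r 0 else r 1) (fun i => by split_ifs <;> exact h _) |>
    fun h' => by
      convert h' using 3 with j
      funext i
      split_ifs <;> rfl
  idem c hc := by simpa using hfC c hc

variable {ι : Type*}

/-- The componentwise action on tuples. -/
def ap (f : BinaryPoly L C) (x y : ι → A) : ι → A := fun j => f.toFun (x j) (y j)

theorem ap_self (f : BinaryPoly L C) {x : ι → A} (hx : ∀ j, x j ∈ C) : f.ap x x = x :=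
  funext fun j => f.idem _ (hx j)

theorem ap_sameOrbit [Finite ι] [L.IsRelational] (hcore : IsModelCompleteCore L A)
    (f : BinaryPoly L C) {t x y : ι → A} (hx : SameOrbit L t x) (hy : SameOrbit L t y) :
    SameOrbit L t (f.ap x y) := by
  refine IsPoly.sameOrbit hcore (f := fun v : Fin 2 → A => f.toFun (v 0) (v 1)) f.isPoly (t := t)
    (r := fun i => if i = 0 then x else y) fun i => ?_
  split_ifs
  exacts [hx, hy]

end BinaryPoly

variable {ι : Type*}

/-- A binary relation on tuples that is preserved by all polymorphisms. -/
def IsInvariantGraph (L : FirstOrder.Language.{v, w}) {A : Type u} [L.Structure A] {ι : Type*}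
    (G : (ι → A) → (ι → A) → Prop) : Prop :=
  ∀ {m : ℕ} (f : (Fin m → A) → A), IsPoly L f → ∀ r r' : Fin m → ι → A,
    (∀ i, G (r i) (r' i)) → G (lift f r) (lift f r')

/-- An invariant graph with a height function that depends on orbits only, and two adjacent
base points. -/
structure HeightData (L : FirstOrder.Language.{v, w}) {A : Type u} [L.Structure A] {ι : Type*}
    (G : (ι → A) → (ι → A) → Prop) (h : (ι → A) → (ι → A) → ℤ) (w₀ w₁ : ι → A) (P : ℕ) :
    Prop where
  symm : ∀ x y, G x y → G y x
  inv : IsInvariantGraph L G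
  height : IsHeight G h
  orbit : ∀ x x' y y', SameOrbit L x x' → SameOrbit L y y' → h x y = h x' y'
  adj : G w₀ w₁
  even : Even P
  pos : 0 < P

/-- The entries of the two base points. -/
def baseEntries (w₀ w₁ : ι → A) : Set A := Set.range w₀ ∪ Set.range w₁

/-- The vector of the heights of the images of a closed walk under the binary polymorphisms, with
the second argument alternating between the base points. -/
def heightVector (L : FirstOrder.Language.{v, w}) {A : Type u} [L.Structure A] {ι : Type*}
    (h : (ι → A) → (ι → A) → ℤ) (w₀ w₁ : ι → A) (P : ℕ) (δ : ℕ → ι → A)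
    (g : BinaryPoly L (baseEntries w₀ w₁)) : ℤ :=
  walkHeight h P (fun i => g.ap (δ i) (alternate w₀ w₁ i)) 0

theorem alternate_mem (w₀ w₁ : ι → A) (i : ℕ) (j : ι) :
    alternate w₀ w₁ i j ∈ baseEntries w₀ w₁ := by
  unfold alternate
  split_ifs
  · exact Or.inl ⟨j, rfl⟩
  · exact Or.inr ⟨j, rfl⟩

namespace HeightData

variable {G : (ι → A) → (ι → A) → Prop} {h : (ι → A) → (ι → A) → ℤ} {w₀ w₁ : ι → A} {P : ℕ}
  (D : HeightData L G h w₀ w₁ P)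

include D

theorem adj_ap {C : Set A} (g : BinaryPoly L C) {x x' y y' : ι → A} (hx : G x x') (hy : G y y') :
    G (g.ap x y) (g.ap x' y') := by
  refine D.inv (fun v : Fin 2 → A => g.toFun (v 0) (v 1)) g.isPoly
    (fun i => if i = 0 then x else y) (fun i => if i = 0 then x' else y') fun i => ?_
  split_ifs
  exacts [hx, hy]

theorem isLoop_base : IsLoop G w₀ P (alternate w₀ w₁) := isLoop_alternate D.symm D.even D.adj

theorem isLoop_ap (g : BinaryPoly L (baseEntries w₀ w₁)) {a b : ℕ → ι → A}
    (ha : IsLoop G w₀ P a) (hb : IsLoop G w₀ P b) : IsLoop G w₀ P fun i => g.ap (a i) (b i) where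
  start := by
    rw [ha.start, hb.start]
    exact g.ap_self fun j => Or.inl ⟨j, rfl⟩
  adj i := D.adj_ap g (ha.adj i) (hb.adj i)
  period i := by rw [ha.period, hb.period]

theorem heightVector_base : heightVector L h w₀ w₁ P (alternate w₀ w₁) = 0 := by
  funext g
  have : (fun i => g.ap (alternate w₀ w₁ i) (alternate w₀ w₁ i)) = alternate w₀ w₁ :=
    funext fun i => g.ap_self (alternate_mem w₀ w₁ i)
  rw [heightVector, this, walkHeight_alternate D.even]
  rfl

/-- An instance of `walkHeight_product`. The alternating second argument of g is absorbed into the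
dependence of F on time, which is why F is there allowed to have period two. -/
theorem heightVector_ap (f : BinaryPoly L (baseEntries w₀ w₁)) {a b : ℕ → ι → A}
    (ha : IsLoop G w₀ P a) (hb : IsLoop G w₀ P b) :
    heightVector L h w₀ w₁ P (fun i => f.ap (a i) (b i)) =
      heightVector L h w₀ w₁ P (fun i => f.ap (a i) (alternate w₀ w₁ i)) +
      heightVector L h w₀ w₁ P (fun i => f.ap (alternate w₀ w₁ i) (b i)) := by
  funext g
  refine walkHeight_product (GY := G) (GZ := G) D.height D.symm D.symm D.symm
    (F := fun i y z => g.ap (f.ap y z) (alternate w₀ w₁ i)) ?_ ?_ D.even D.pos D.adj D.adj ha hb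
  · intro i y y' z z' hy hz
    exact D.adj_ap g (D.adj_ap f hy hz) (D.isLoop_base.adj i)
  · intro i y z
    rw [alternate_add even_two]

theorem arc_orbit {x x' y y' : ι → A} (hx : SameOrbit L x x') (hy : SameOrbit L y y') (i : ℕ) :
    arc h i x y = arc h i x' y' := by
  rw [arc, arc, D.orbit x x' y y' hx hy, D.orbit y y' x x' hy hx]

theorem walkHeight_orbit {γ γ' : ℕ → ι → A} (hγ : ∀ i, SameOrbit L (γ i) (γ' i)) (n : ℕ) :
    walkHeight h n γ 0 = walkHeight h n γ' 0 :=
  Finset.sum_congr rfl fun i _ => D.arc_orbit (hγ i) (hγ (i + 1)) _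

variable [L.IsRelational] [Finite ι] (hcore : IsModelCompleteCore L A)

include hcore

/-- The height vector of a closed walk depends only on the orbits that the walk visits. -/
theorem heightVector_eq_of_sameOrbit {a b : ℕ → ι → A} (ha : IsLoop G w₀ P a)
    (hb : IsLoop G w₀ P b) (hab : ∀ i, SameOrbit L (a i) (b i)) :
    heightVector L h w₀ w₁ P a = heightVector L h w₀ w₁ P b := by
  funext g
  -- The walk g(c, a) visits the same orbits as a and so has the height of a. Splitting this product
  -- isolates the coordinate g of the height vector of c, and the other summand does not involve c.
  have key : ∀ c : ℕ → ι → A, IsLoop G w₀ P c → (∀ i, SameOrbit L (a i) (c i)) →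
      walkHeight h P a 0 = heightVector L h w₀ w₁ P c g +
        walkHeight h P (fun i => (g.subst .snd .fst).ap (a i) (alternate w₀ w₁ i)) 0 := by
    intro c hc hac
    rw [D.walkHeight_orbit (γ' := fun i => g.ap (c i) (a i)) fun i =>
      g.ap_sameOrbit hcore (hac i) (SameOrbit.refl _)]
    refine walkHeight_product (GY := G) (GZ := G) D.height D.symm D.symm D.symm
      (F := fun _ y z => g.ap y z) ?_ ?_ D.even D.pos D.adj D.adj hc ha
    · intro i y y' z z' hy hz
      exact D.adj_ap g hy hz
    · intro i y z
      rfl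
  have h1 := key a ha fun i => SameOrbit.refl _
  have h2 := key b hb hab
  linarith

/-- As f(a, a) visits the orbits of a, the operators belonging to the two arguments of f add up to
the identity. -/
theorem heightVector_ap_self (f : BinaryPoly L (baseEntries w₀ w₁)) {a : ℕ → ι → A}
    (ha : IsLoop G w₀ P a) :
    heightVector L h w₀ w₁ P (fun i => f.ap (a i) (alternate w₀ w₁ i)) +
      heightVector L h w₀ w₁ P (fun i => f.ap (alternate w₀ w₁ i) (a i)) =
      heightVector L h w₀ w₁ P a := by
  rw [← D.heightVector_ap f ha ha]
  exact (D.heightVector_eq_of_sameOrbit hcore ha (D.isLoop_ap f ha ha) fun i =>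
    f.ap_sameOrbit hcore (SameOrbit.refl _) (SameOrbit.refl _)).symm

end HeightData

/-- Composition with a binary operation, acting on height vectors. -/
def actHom {C : Set A} (f : BinaryPoly L C) : (BinaryPoly L C → ℤ) →+ (BinaryPoly L C → ℤ) where
  toFun φ g := φ (g.subst f .snd)
  map_zero' := rfl
  map_add' _ _ := rfl

/-- The height vectors of the images of a closed walk. -/
def imageVectors (L : FirstOrder.Language.{v, w}) {A : Type u} [L.Structure A] {ι : Type*}
    (h : (ι → A) → (ι → A) → ℤ) (w₀ w₁ : ι → A) (P : ℕ) (δ : ℕ → ι → A) :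
    Set (BinaryPoly L (baseEntries w₀ w₁) → ℤ) :=
  Set.range fun f : BinaryPoly L (baseEntries w₀ w₁) =>
    heightVector L h w₀ w₁ P fun i => f.ap (δ i) (alternate w₀ w₁ i)

/-- Recording the heights under all g makes the action a substitution of coordinates: the vector of
f(δ, idle) is by definition `actHom f` of the vector of δ. -/
theorem actHom_mem_imageVectors {h : (ι → A) → (ι → A) → ℤ} {w₀ w₁ : ι → A} {P : ℕ}
    {δ : ℕ → ι → A} (f : BinaryPoly L (baseEntries w₀ w₁)) :
    ∀ v ∈ imageVectors L h w₀ w₁ P δ, actHom f v ∈ imageVectors L h w₀ w₁ P δ := by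
  rintro _ ⟨f', rfl⟩
  exact ⟨f.subst f' .snd, rfl⟩

theorem actHom_mem_closure {h : (ι → A) → (ι → A) → ℤ} {w₀ w₁ : ι → A} {P : ℕ}
    {δ : ℕ → ι → A} (f : BinaryPoly L (baseEntries w₀ w₁)) :
    ∀ v ∈ AddSubgroup.closure (imageVectors L h w₀ w₁ P δ),
      actHom f v ∈ AddSubgroup.closure (imageVectors L h w₀ w₁ P δ) := by
  intro v hv
  induction hv using AddSubgroup.closure_induction with
  | mem x hx => exact AddSubgroup.subset_closure (actHom_mem_imageVectors f x hx)
  | zero => rw [map_zero]; exact zero_mem _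
  | add x y _ _ hx hy => rw [map_add]; exact add_mem hx hy
  | neg x _ hx => rw [map_neg]; exact neg_mem hx

/-- The action on the group generated by the height vectors of the images of a closed walk. -/
def actEnd (h : (ι → A) → (ι → A) → ℤ) (w₀ w₁ : ι → A) (P : ℕ) (δ : ℕ → ι → A)
    (f : BinaryPoly L (baseEntries w₀ w₁)) :
    AddMonoid.End (AddSubgroup.closure (imageVectors L h w₀ w₁ P δ)) :=
  ((actHom f).comp (AddSubgroup.subtype _)).codRestrict _ fun v => actHom_mem_closure f v.1 v.2

theorem end_ext {M : Type*} [AddCommGroup M] {B : Set M}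
    {φ ψ : AddMonoid.End (AddSubgroup.closure B)}
    (hφ : ∀ (v : M) (hv : v ∈ B), φ ⟨v, AddSubgroup.subset_closure hv⟩ =
      ψ ⟨v, AddSubgroup.subset_closure hv⟩) : φ = ψ := by
  refine AddMonoidHom.ext ?_
  rintro ⟨v, hv⟩
  induction hv using AddSubgroup.closure_induction with
  | mem x hx => exact hφ x hx
  | zero => exact (map_zero φ).trans (map_zero ψ).symm
  | add x y hx hy h1 h2 =>
    have e : (⟨x + y, add_mem hx hy⟩ : AddSubgroup.closure B) = ⟨x, hx⟩ + ⟨y, hy⟩ := rfl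
    exact (congrArg φ e).trans ((map_add φ _ _).trans
      ((congrArg₂ (· + ·) h1 h2).trans (map_add ψ _ _).symm))
  | neg x hx h1 =>
    have e : (⟨-x, neg_mem hx⟩ : AddSubgroup.closure B) = -⟨x, hx⟩ := rfl
    exact (congrArg φ e).trans ((map_neg φ _).trans ((congrArg Neg.neg h1).trans (map_neg ψ _).symm))

namespace HeightData

variable {G : (ι → A) → (ι → A) → Prop} {h : (ι → A) → (ι → A) → ℤ} {w₀ w₁ : ι → A} {P : ℕ}
  (D : HeightData L G h w₀ w₁ P)

include D

/-- A vector depends only on the orbits visited during one period, for which there are finitely many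
possibilities. -/
theorem finite_imageVectors [L.IsRelational] [Finite ι] (hcore : IsModelCompleteCore L A)
    (hcat : IsOmegaCategorical L A) {δ : ℕ → ι → A} (hδ : IsLoop G w₀ P δ) :
    (imageVectors L h w₀ w₁ P δ).Finite := by
  have := hcat.finite_orbits ι
  let q : BinaryPoly L (baseEntries w₀ w₁) → Fin P → Quotient (tupleSetoid L A ι) :=
    fun f i => Quotient.mk _ (f.ap (δ i) (alternate w₀ w₁ i))
  choose r hr using fun c : Set.range q => c.2
  refine (Set.finite_range fun c : Set.range q => heightVector L h w₀ w₁ P fun i =>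
    (r c).ap (δ i) (alternate w₀ w₁ i)).subset ?_
  rintro _ ⟨f, rfl⟩
  refine ⟨⟨q f, f, rfl⟩, ?_⟩
  have hl := D.isLoop_ap (r ⟨q f, f, rfl⟩) hδ D.isLoop_base
  have hl' := D.isLoop_ap f hδ D.isLoop_base
  refine D.heightVector_eq_of_sameOrbit hcore hl hl' fun i => ?_
  have h1 := hl.mod i
  have h2 := hl'.mod i
  rw [← h1, ← h2]
  exact Quotient.exact (congrFun (hr ⟨q f, f, rfl⟩) ⟨i % P, Nat.mod_lt _ D.pos⟩)

/-- The first projection gives 1, exchanging the arguments of f gives 1 - x, and f(g, k) gives x y +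
(1 - x) z. An operator is determined by how it moves the finitely many generators, hence finiteness.
-/
theorem isCoefficientSet [L.IsRelational] [Finite ι] (hcore : IsModelCompleteCore L A)
    (hcat : IsOmegaCategorical L A) {δ : ℕ → ι → A} (hδ : IsLoop G w₀ P δ) :
    IsCoefficientSet (Set.range (actEnd (L := L) h w₀ w₁ P δ)) := by
  have hloop : ∀ f : BinaryPoly L (baseEntries w₀ w₁),
      IsLoop G w₀ P fun i => f.ap (δ i) (alternate w₀ w₁ i) :=
    fun f => D.isLoop_ap f hδ D.isLoop_base
  have hcompl : ∀ f : BinaryPoly L (baseEntries w₀ w₁),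
      1 - actEnd h w₀ w₁ P δ f = actEnd h w₀ w₁ P δ (f.subst .snd .fst) := by
    intro f
    refine end_ext ?_
    rintro _ ⟨g, rfl⟩
    refine Subtype.ext ?_
    refine sub_eq_of_eq_add ?_
    have := D.heightVector_ap_self hcore f (hloop g)
    rw [add_comm] at this
    exact this.symm
  refine ⟨?_, ⟨.fst, rfl⟩, ?_, ?_⟩
  · have hfin := (D.finite_imageVectors hcore hcat hδ).to_subtype
    let res : Set.range (actEnd (L := L) h w₀ w₁ P δ) →
        (imageVectors L h w₀ w₁ P δ → imageVectors L h w₀ w₁ P δ) := fun φ v =>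
      ⟨(φ.1 ⟨v.1, AddSubgroup.subset_closure v.2⟩).1, by
        obtain ⟨_, f, rfl⟩ := φ
        exact actHom_mem_imageVectors f v.1 v.2⟩
    have hinj : Function.Injective res := by
      intro φ ψ hφψ
      refine Subtype.ext (end_ext fun v hv => Subtype.ext ?_)
      have := congrArg Subtype.val (congrFun hφψ ⟨v, hv⟩)
      exact this
    have := Finite.of_injective res hinj
    exact Set.toFinite _
  · rintro _ ⟨f, rfl⟩
    exact ⟨_, (hcompl f).symm⟩
  · rintro _ ⟨f, rfl⟩ _ ⟨g, rfl⟩ _ ⟨k, rfl⟩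
    refine ⟨f.subst g k, ?_⟩
    rw [hcompl]
    refine end_ext ?_
    rintro _ ⟨f', rfl⟩
    refine Subtype.ext ?_
    have h1 := D.isLoop_ap g (hloop f') D.isLoop_base
    have h2 := D.isLoop_ap k (hloop f') D.isLoop_base
    exact D.heightVector_ap f h1 h2

/-- There is a closed walk on whose height vector every binary polymorphism that fixes the base
points acts as zero or as the identity. -/
theorem exists_minimal_loop [L.IsRelational] [Finite ι] (hcore : IsModelCompleteCore L A)
    (hcat : IsOmegaCategorical L A) {δ : ℕ → ι → A} (hδ : IsLoop G w₀ P δ)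
    (hne : walkHeight h P δ 0 ≠ 0) :
    ∃ ε : ℕ → ι → A, IsLoop G w₀ P ε ∧ heightVector L h w₀ w₁ P ε ≠ 0 ∧
      ∀ f : BinaryPoly L (baseEntries w₀ w₁),
        heightVector L h w₀ w₁ P (fun i => f.ap (ε i) (alternate w₀ w₁ i)) = 0 ∨
        heightVector L h w₀ w₁ P (fun i => f.ap (ε i) (alternate w₀ w₁ i)) =
          heightVector L h w₀ w₁ P ε := by
  have hS := D.isCoefficientSet hcore hcat hδ
  have hmul : ∀ (n : ℕ) (x : AddMonoid.End (AddSubgroup.closure (imageVectors L h w₀ w₁ P δ)))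
      (v : AddSubgroup.closure (imageVectors L h w₀ w₁ P δ))
      (g : BinaryPoly L (baseEntries w₀ w₁)),
      (((n : AddMonoid.End (AddSubgroup.closure (imageVectors L h w₀ w₁ P δ))) * x) v).1 g =
        n * (x v).1 g := by
    intro n x v g
    rw [← nsmul_eq_mul]
    simp
  -- Both ring hypotheses hold because the operators act on integer-valued functions; an integer t
  -- divisible by 2 ^ |t| is 0.
  obtain ⟨_, ⟨e, rfl⟩, he0, he⟩ := hS.exists_minimal
    (fun n x hn hx => by
      refine AddMonoidHom.ext fun v => Subtype.ext (funext fun g => ?_)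
      have h1 := congrArg (fun y => y.1 g) (DFunLike.congr_fun hx v)
      have h3 : (n : ℤ) * (x v).1 g = 0 := (hmul n x v g).symm.trans h1
      exact (mul_eq_zero.mp h3).resolve_left (by exact_mod_cast hn))
    (fun x hx => by
      refine AddMonoidHom.ext fun v => Subtype.ext (funext fun g => ?_)
      obtain ⟨y, hy⟩ := hx ((x v).1 g).natAbs
      have h1 : (x v).1 g = ((2 ^ ((x v).1 g).natAbs : ℕ) : ℤ) * (y v).1 g := by
        rw [← hmul]
        push_cast
        exact congrArg (fun z => (z v).1 g) hy
      refine Int.eq_zero_of_dvd_of_natAbs_lt_natAbs (Dvd.intro _ h1.symm) ?_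
      rw [Int.natAbs_natCast]
      exact Nat.lt_two_pow_self)
    (fun h10 => hne (by
      have h1 := DFunLike.congr_fun h10 ⟨_, AddSubgroup.subset_closure ⟨.fst, rfl⟩⟩
      exact congrFun (congrArg Subtype.val h1) .fst))
  -- The minimal operator is nonzero on some generator; applying e to the corresponding loop gives
  -- the required walk.
  have hex : ∃ v, ∃ hv : v ∈ imageVectors L h w₀ w₁ P δ,
      actEnd h w₀ w₁ P δ e ⟨v, AddSubgroup.subset_closure hv⟩ ≠ 0 := by
    by_contra! hcon
    exact he0 (end_ext hcon)
  obtain ⟨_, ⟨f', rfl⟩, hv⟩ := hex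
  have hl := D.isLoop_ap f' hδ D.isLoop_base
  refine ⟨_, D.isLoop_ap e hl D.isLoop_base, fun h0 => hv (Subtype.ext h0), fun f => ?_⟩
  refine (he _ ⟨f, rfl⟩).imp (fun h0 => ?_) fun h1 => ?_
  · have := congrArg Subtype.val
      (DFunLike.congr_fun h0 ⟨_, AddSubgroup.subset_closure ⟨f', rfl⟩⟩)
    exact this
  · have := congrArg Subtype.val
      (DFunLike.congr_fun h1 ⟨_, AddSubgroup.subset_closure ⟨f', rfl⟩⟩)
    exact this

end HeightData

end Degree

/-! ### From coefficients 0 and 1 to projections -/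

section Projections

variable {L : FirstOrder.Language.{v, w}} {A : Type u} [L.Structure A] {ι : Type*}
  {G : (ι → A) → (ι → A) → Prop} {h : (ι → A) → (ι → A) → ℤ} {w₀ w₁ : ι → A} {P : ℕ}

theorem alternate_pi {X κ : Type*} (y z : κ → X) (i : ℕ) (j : κ) :
    alternate y z i j = alternate (y j) (z j) i := by
  unfold alternate
  split_ifs <;> rfl

namespace HeightData

variable (D : HeightData L G h w₀ w₁ P)

include D

theorem isLoop_lift {m : ℕ} {f : (Fin m → A) → A} (hf : IsPoly L f)
    (hfC : Fixes f (baseEntries w₀ w₁)) {r : Fin m → ℕ → ι → A} (hr : ∀ j, IsLoop G w₀ P (r j)) :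
    IsLoop G w₀ P fun i => lift f fun j => r j i where
  start := by
    funext t
    simp only [lift, (hr _).start]
    exact hfC _ (Or.inl ⟨t, rfl⟩)
  adj i := D.inv f hf _ _ fun j => (hr j).adj i
  period i := by simp only [(hr _).period]

/-- Coordinates are released from the alternating walk one at a time; `walkHeight_product` on
m-tuples of walks separates the new coordinate q from those in S. -/
theorem heightVector_lift_finset {m : ℕ} {f : (Fin m → A) → A} (hf : IsPoly L f)
    (hfC : Fixes f (baseEntries w₀ w₁)) {r : Fin m → ℕ → ι → A} (hr : ∀ j, IsLoop G w₀ P (r j))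
    (S : Finset (Fin m)) :
    heightVector L h w₀ w₁ P
      (fun i => lift f fun j => if j ∈ S then r j i else alternate w₀ w₁ i) =
    ∑ j ∈ S, heightVector L h w₀ w₁ P (fun i =>
      (BinaryPoly.minor f hf hfC fun l => decide (l = j)).ap (r j i) (alternate w₀ w₁ i)) := by
  induction S using Finset.induction_on with
  | empty =>
    have : (fun i => lift f fun j : Fin m => if j ∈ (∅ : Finset (Fin m)) then r j i else
        alternate w₀ w₁ i) = alternate w₀ w₁ :=
      funext fun i => funext fun t => by
        simpa [lift] using hfC _ (alternate_mem w₀ w₁ i t)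
    rw [this, D.heightVector_base, Finset.sum_empty]
  | insert q S hq ih =>
    rw [Finset.sum_insert hq, ← ih, add_comm]
    funext g
    have hsY : ∀ x y : Fin m → ι → A, (∀ j, G (x j) (y j)) → ∀ j, G (y j) (x j) :=
      fun x y hxy j => D.symm _ _ (hxy j)
    have key := walkHeight_product (GY := fun y z : Fin m → ι → A => ∀ j, G (y j) (z j))
      (GZ := fun y z : Fin m → ι → A => ∀ j, G (y j) (z j)) D.height D.symm hsY hsY
      (F := fun i y z => g.ap (lift f fun j => if j = q then z j else y j) (alternate w₀ w₁ i))
      (y := fun _ => w₀) (y₁ := fun _ => w₁) (z := fun _ => w₀) (z₁ := fun _ => w₁)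
      (a := fun i j => if j ∈ S then r j i else alternate w₀ w₁ i)
      (b := fun i j => if j = q then r q i else alternate w₀ w₁ i) ?_ ?_ D.even D.pos
      (fun _ => D.adj) (fun _ => D.adj) ?_ ?_
    · refine Eq.trans ?_ (key.trans (congrArg₂ (· + ·) ?_ ?_))
      · refine congrArg (fun γ => walkHeight h P γ 0) (funext fun i => ?_)
        refine congrArg (fun x => g.ap (lift f x) _) (funext fun j => ?_)
        by_cases hj : j = q <;> simp [hj]
      · refine congrArg (fun γ => walkHeight h P γ 0) (funext fun i => ?_)
        refine congrArg (fun x => g.ap (lift f x) _) (funext fun j => ?_)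
        by_cases hj : j = q <;> simp [hj, hq, alternate_pi]
      · refine congrArg (fun γ => walkHeight h P γ 0) (funext fun i => ?_)
        refine congrArg (fun x => g.ap x _) (funext fun t => ?_)
        refine congrArg f (funext fun j => ?_)
        by_cases hj : j = q <;> simp [hj, alternate_pi]
    · intro i y y' z z' hy hz
      refine D.adj_ap g (D.inv f hf _ _ fun j => ?_) (D.isLoop_base.adj i)
      split_ifs
      exacts [hz j, hy j]
    · intro i y z
      rw [alternate_add even_two]
    · refine ⟨funext fun j => ?_, fun i j => ?_, fun i => funext fun j => ?_⟩
      · split_ifs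
        exacts [(hr j).start, D.isLoop_base.start]
      · split_ifs
        exacts [(hr j).adj i, D.isLoop_base.adj i]
      · split_ifs
        exacts [(hr j).period i, D.isLoop_base.period i]
    · refine ⟨funext fun j => ?_, fun i j => ?_, fun i => funext fun j => ?_⟩
      · split_ifs
        exacts [(hr q).start, D.isLoop_base.start]
      · split_ifs
        exacts [(hr q).adj i, D.isLoop_base.adj i]
      · split_ifs
        exacts [(hr q).period i, D.isLoop_base.period i]

theorem heightVector_lift {m : ℕ} {f : (Fin m → A) → A} (hf : IsPoly L f)
    (hfC : Fixes f (baseEntries w₀ w₁)) {r : Fin m → ℕ → ι → A}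
    (hr : ∀ j, IsLoop G w₀ P (r j)) :
    heightVector L h w₀ w₁ P (fun i => lift f fun j => r j i) =
    ∑ j, heightVector L h w₀ w₁ P (fun i =>
      (BinaryPoly.minor f hf hfC fun l => decide (l = j)).ap (r j i) (alternate w₀ w₁ i)) := by
  simpa using D.heightVector_lift_finset hf hfC hr Finset.univ

/-- Polymorphisms that fix the base points act on the closed walks whose height vector is zero
or a fixed minimal vector as projections. -/
theorem exists_projection [L.IsRelational] [Finite ι] (hcore : IsModelCompleteCore L A)
    {ε : ℕ → ι → A} (hε : IsLoop G w₀ P ε) (hne : heightVector L h w₀ w₁ P ε ≠ 0)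
    (hmin : ∀ f : BinaryPoly L (baseEntries w₀ w₁),
        heightVector L h w₀ w₁ P (fun i => f.ap (ε i) (alternate w₀ w₁ i)) = 0 ∨
        heightVector L h w₀ w₁ P (fun i => f.ap (ε i) (alternate w₀ w₁ i)) =
          heightVector L h w₀ w₁ P ε)
    {m : ℕ} {f : (Fin m → A) → A} (hf : IsPoly L f) (hfC : Fixes f (baseEntries w₀ w₁)) :
    ∃ q : Fin m, ∀ (b : Fin m → Bool) (r : Fin m → ℕ → ι → A), (∀ j, IsLoop G w₀ P (r j)) →
      (∀ j, heightVector L h w₀ w₁ P (r j) = if b j then heightVector L h w₀ w₁ P ε else 0) →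
      heightVector L h w₀ w₁ P (fun i => lift f fun j => r j i) =
        if b q then heightVector L h w₀ w₁ P ε else 0 := by
  classical
  set v := heightVector L h w₀ w₁ P ε with hv
  let mn : Fin m → BinaryPoly L (baseEntries w₀ w₁) :=
    fun j => BinaryPoly.minor f hf hfC fun l => decide (l = j)
  have hc : ∀ j, ∃ c : Bool, actHom (mn j) v = if c then v else 0 := by
    intro j
    rcases hmin (mn j) with h0 | h1
    · exact ⟨false, h0⟩
    · exact ⟨true, h1⟩
  choose c hc using hc
  obtain ⟨g, hg⟩ := Function.ne_iff.mp hne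
  -- f(ε, …, ε) visits the orbits of ε and so has the vector v. Hence the coefficients c j, each 0
  -- or 1, sum to 1, and exactly one of them is 1.
  have hsum : ∑ j, (if c j then v else 0) = v := by
    have h1 := D.heightVector_lift hf hfC fun _ => hε
    have h2 : heightVector L h w₀ w₁ P (fun i => lift f fun _ => ε i) = v :=
      (D.heightVector_eq_of_sameOrbit hcore hε (D.isLoop_lift hf hfC fun _ => hε) fun i =>
        IsPoly.sameOrbit hcore hf fun _ => SameOrbit.refl _).symm
    rw [h2] at h1
    exact (Finset.sum_congr rfl fun j _ => (hc j).symm).trans h1.symm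
  have hcard : (Finset.univ.filter fun j => c j = true).card = 1 := by
    have h1 := congrFun hsum g
    rw [Finset.sum_ite, Finset.sum_const_zero, add_zero, Finset.sum_const, Pi.smul_apply,
      nsmul_eq_mul] at h1
    have h2 := mul_right_cancel₀ hg (h1.trans (one_mul _).symm)
    exact_mod_cast h2
  obtain ⟨q, hq⟩ := Finset.card_eq_one.mp hcard
  have hq' : ∀ j, c j = true ↔ j = q := fun j => by
    have := Finset.ext_iff.mp hq j
    simpa using this
  refine ⟨q, fun b r hr hrv => ?_⟩
  rw [D.heightVector_lift hf hfC hr, Finset.sum_eq_single q]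
  · have h1 : actHom (mn q) (heightVector L h w₀ w₁ P (r q)) = if b q then v else 0 := by
      rw [hrv q]
      by_cases hb : b q
      · simp only [hb, if_true]
        rw [hc q, if_pos ((hq' q).mpr rfl)]
      · simp [hb]
    exact h1
  · intro j _ hj
    have h1 : actHom (mn j) (heightVector L h w₀ w₁ P (r j)) = 0 := by
      rw [hrv j]
      by_cases hb : b j
      · simp only [hb, if_true]
        rw [hc j, if_neg fun h => hj ((hq' j).mp h)]
      · simp [hb]
    exact h1
  · intro h
    exact absurd (Finset.mem_univ q) h

/-- An invariant graph with a height function that does not vanish on some closed walk gives rise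
to interpretations of all finite structures. -/
theorem interpretsAll [L.IsRelational] [Finite ι] [Nonempty ι] (hcore : IsModelCompleteCore L A)
    (hcat : IsOmegaCategorical L A) {δ : ℕ → ι → A} (hδ : IsLoop G w₀ P δ)
    (hδ0 : walkHeight h P δ 0 ≠ 0) : PPInterpretsAllFiniteWithParameters L A := by
  classical
  obtain ⟨ε, hε, hne, hmin⟩ := D.exists_minimal_loop hcore hcat hδ hδ0
  have : Nonempty (Fin P) := ⟨⟨0, D.pos⟩⟩
  let unroll : (Fin P × ι → A) → ℕ → ι → A := fun r i j => r (⟨i % P, Nat.mod_lt _ D.pos⟩, j)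
  have hun : ∀ δ, IsLoop G w₀ P δ → unroll (fun p => δ p.1 p.2) = δ := fun δ hδ =>
    funext fun i => hδ.mod i
  have hfin : (baseEntries w₀ w₁).Finite := (Set.finite_range _).union (Set.finite_range _)
  refine ActsByProjections.interpretsAll hcat hfin.toFinset (κ := Fin P × ι)
    (Z := fun b => {r | IsLoop G w₀ P (unroll r) ∧ heightVector L h w₀ w₁ P (unroll r) =
      if b then heightVector L h w₀ w₁ P ε else 0}) ⟨?_, ?_, ?_⟩
  · refine Set.disjoint_left.mpr ?_
    rintro r ⟨-, h1⟩ ⟨-, h2⟩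
    exact hne (by simpa [h1] using h2.symm)
  · rintro (_ | _)
    · refine ⟨fun p => alternate w₀ w₁ p.1 p.2, ?_, ?_⟩
      · rw [hun _ D.isLoop_base]; exact D.isLoop_base
      · rw [hun _ D.isLoop_base, D.heightVector_base]; rfl
    · refine ⟨fun p => ε p.1 p.2, ?_, ?_⟩
      · rw [hun _ hε]; exact hε
      · rw [hun _ hε]; rfl
  · intro m f hf hfC
    rw [hfin.coe_toFinset] at hfC
    obtain ⟨q, hq⟩ := D.exists_projection hcore hε hne hmin hf hfC
    refine ⟨q, fun b r hr => ⟨?_, ?_⟩⟩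
    · exact D.isLoop_lift hf hfC fun j => (hr j).1
    · exact hq b (fun j => unroll (r j)) (fun j => (hr j).1) fun j => (hr j).2

end HeightData

end Projections

/-! ### Periodic and reversed walks -/

section LiftedWalk

variable {X : Type*} {G : X → X → Prop} {h : X → X → ℤ}

/-- A finite closed walk, continued periodically. -/
theorem isLoop_mod {P : ℕ} (hP : 0 < P) {E : ℕ → X} (hE : ∀ i < P, G (E i) (E (i + 1)))
    (h0 : E P = E 0) : IsLoop G (E 0) P fun i => E (i % P) where
  start := by rw [Nat.zero_mod]
  period i := by rw [Nat.add_mod_right]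
  adj i := by
    have hlt := Nat.mod_lt i hP
    have h1 := hE _ hlt
    rcases Nat.lt_or_ge (i % P + 1) P with h | h
    · rwa [Nat.add_mod, Nat.mod_eq_of_lt (a := 1) (by omega), Nat.mod_eq_of_lt h]
    · have e : i % P + 1 = P := by omega
      have e' : (i + 1) % P = 0 := by
        rw [← Nat.mod_add_div i P, Nat.add_right_comm, e, Nat.add_mul_mod_self_left, Nat.mod_self]
      rw [e', ← h0]
      rwa [e] at h1

theorem walkHeight_mod {P : ℕ} {E : ℕ → X} (h0 : E P = E 0) :
    walkHeight h P (fun i => E (i % P)) 0 = walkHeight h P E 0 := by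
  refine Finset.sum_congr rfl fun i hi => ?_
  have := Finset.mem_range.mp hi
  beta_reduce
  rw [Nat.mod_eq_of_lt this]
  rcases Nat.lt_or_ge (i + 1) P with h | h
  · rw [Nat.mod_eq_of_lt h]
  · have e : i + 1 = P := by omega
    rw [e, Nat.mod_self, h0]

theorem walkHeight_periodic {n : ℕ} (γ : ℕ → X)
    (hγ : ∀ i, arc h (i + n) (γ (i + n)) (γ (i + n + 1)) = arc h i (γ i) (γ (i + 1))) (l : ℕ) :
    walkHeight h (n * l) γ 0 = l * walkHeight h n γ 0 := by
  have hper : ∀ l i, arc h (n * l + i) (γ (n * l + i)) (γ (n * l + i + 1)) =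
      arc h i (γ i) (γ (i + 1)) := by
    intro l i
    induction l with
    | zero => simp
    | succ l ih => rw [show n * (l + 1) + i = n * l + i + n by ring, hγ, ih]
  induction l with
  | zero => simp [walkHeight]
  | succ l ih =>
    rw [walkHeight] at ih ⊢
    rw [Nat.mul_succ, Finset.sum_range_add, ih, Nat.cast_succ, add_mul, one_mul]
    congr 1
    exact Finset.sum_congr rfl fun i _ => hper l i

theorem walkHeight_reverse {n : ℕ} (hn : Even n) {γ γ' : ℕ → X}
    (hγ : ∀ i ≤ n, γ' i = γ (n - i)) : walkHeight h n γ' 0 = -walkHeight h n γ 0 := by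
  rw [walkHeight, walkHeight, ← Finset.sum_range_reflect, ← Finset.sum_neg_distrib]
  refine Finset.sum_congr rfl fun i hi => ?_
  have := Finset.mem_range.mp hi
  rw [hγ _ (by omega), hγ _ (by omega), show n - (n - 1 - i) = i + 1 by omega,
    show n - (n - 1 - i + 1) = i by omega, Nat.add_zero, Nat.add_zero, ← arc_reverse]
  have : Even (n - 1 - i) ↔ Even (i + 1) := by
    have e : n = (n - 1 - i) + (i + 1) := by omega
    rw [e, Nat.even_add] at hn
    exact hn
  simp only [arc, this]

end LiftedWalk

/-! ### Closing up a triangle modulo automorphisms -/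

section Triangle

variable {L : FirstOrder.Language.{v, w}} {A : Type u} [L.Structure A] {ι : Type*}
  {G : (ι → A) → (ι → A) → Prop}

/-- The componentwise action of an automorphism on tuples. -/
def act (α : A ≃[L] A) (x : ι → A) : ι → A := fun j => α (x j)

theorem sameOrbit_act (α : A ≃[L] A) (x : ι → A) : SameOrbit L x (act α x) := ⟨α, fun _ => rfl⟩

theorem SameOrbit.exists_act {x y : ι → A} (h : SameOrbit L x y) :
    ∃ α : A ≃[L] A, act α x = y := by
  obtain ⟨α, hα⟩ := h
  exact ⟨α, funext hα⟩

theorem IsInvariantGraph.adj_act (hG : IsInvariantGraph L G) (α : A ≃[L] A) {x y : ι → A}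
    (hxy : G x y) : G (act α x) (act α y) :=
  hG (fun v : Fin 1 → A => α (v 0)) (isPoly_equiv_comp (f := fun v => v 0) α (isPoly_proj 0))
    (fun _ => x) (fun _ => y) fun _ => hxy

/-- The walk that runs through the images of a pseudo-triangle under the powers of an
automorphism. -/
def triangleWalk (α : A ≃[L] A) (x y z : ι → A) (i : ℕ) : ι → A :=
  (act α)^[i / 3] (if i % 3 = 0 then x else if i % 3 = 1 then y else z)

theorem triangleWalk_add_three (α : A ≃[L] A) (x y z : ι → A) (i : ℕ) :
    triangleWalk α x y z (i + 3) = act α (triangleWalk α x y z i) := by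
  rw [triangleWalk, triangleWalk, Nat.add_div_right i (by norm_num), Nat.add_mod_right,
    Function.iterate_succ_apply']

theorem adj_triangleWalk (hG : IsInvariantGraph L G) (α : A ≃[L] A) {x y z : ι → A}
    (hxy : G x y) (hyz : G y z) (hzx : G z (act α x)) (i : ℕ) :
    G (triangleWalk α x y z i) (triangleWalk α x y z (i + 1)) := by
  induction i using Nat.strong_induction_on with
  | _ i ih =>
    rcases Nat.lt_or_ge i 3 with h | h
    · interval_cases i
      · exact hxy
      · exact hyz
      · exact hzx
    · obtain ⟨j, rfl⟩ := Nat.exists_eq_add_of_le' h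
      rw [Nat.add_right_comm, triangleWalk_add_three, triangleWalk_add_three]
      exact hG.adj_act α (ih j (by omega))

/-- An invariant graph with a height function that does not vanish on a pseudo-triangle that is
traversed twice gives rise to interpretations of all finite structures. -/
theorem interpretsAll_of_triangle [L.IsRelational] [Finite ι] [Nonempty ι]
    (hcat : IsOmegaCategorical L A) (hcore : IsModelCompleteCore L A)
    (hs : ∀ x y, G x y → G y x) (hG : IsInvariantGraph L G) {h : (ι → A) → (ι → A) → ℤ}
    (hh : IsHeight G h)
    (horb : ∀ x x' y y', SameOrbit L x x' → SameOrbit L y y' → h x y = h x' y')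
    {x y z x' : ι → A} (hxy : G x y) (hyz : G y z) (hzx : G z x') (hx : SameOrbit L x x')
    (hval : h x y - h z y + h z x - h y x + h y z - h x z = 1) :
    PPInterpretsAllFiniteWithParameters L A := by
  obtain ⟨α, rfl⟩ := hx.exists_act
  set W := triangleWalk α x y z with hW
  have hW3 : ∀ i, SameOrbit L (W i) (W (i + 3)) := fun i => by
    rw [hW, triangleWalk_add_three]; exact sameOrbit_act α _
  have hWadj : ∀ i, G (W i) (W (i + 1)) := adj_triangleWalk hG α hxy hyz hzx
  have arcorb : ∀ (i : ℕ) {a a' b b' : ι → A}, SameOrbit L a a' → SameOrbit L b b' →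
      arc h i a b = arc h i a' b' := by
    intro i a a' b b' ha hb
    rw [arc, arc, horb a a' b b' ha hb, horb b b' a a' hb ha]
  -- The period is two rounds of the triangle, since a single round has odd length and would
  -- exchange the signs of the arcs.
  have hper : ∀ i, arc h (i + 6) (W (i + 6)) (W (i + 6 + 1)) = arc h i (W i) (W (i + 1)) := by
    intro i
    rw [arc_add_even (by decide)]
    refine arcorb i ?_ ?_
    · exact ((hW3 i).trans (hW3 (i + 3))).symm
    · exact ((hW3 (i + 1)).trans (hW3 (i + 1 + 3))).symm
  have hone : walkHeight h 6 W 0 = 1 := by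
    have o3 : SameOrbit L x (W 3) := hW3 0
    have o4 : SameOrbit L y (W 4) := hW3 1
    have o5 : SameOrbit L z (W 5) := hW3 2
    have o6 : SameOrbit L x (W 6) := (hW3 0).trans (hW3 3)
    rw [walkHeight]
    simp only [Finset.sum_range_succ, Finset.sum_range_zero, zero_add]
    change arc h 0 x y + arc h 1 y z + arc h 2 z (W 3) + arc h 3 (W 3) (W 4) +
      arc h 4 (W 4) (W 5) + arc h 5 (W 5) (W 6) = 1
    rw [← hval, ← arcorb 2 (SameOrbit.refl z) o3, ← arcorb 3 o3 o4, ← arcorb 4 o4 o5,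
      ← arcorb 5 o5 o6]
    simp only [arc]
    norm_num [Nat.even_iff]
    ring
  have hht : ∀ l : ℕ, walkHeight h (6 * l) W 0 = l := fun l => by
    rw [walkHeight_periodic W hper, hone, mul_one]
  obtain ⟨k, l, hkl, β, hβ0, hβ1⟩ : ∃ k l : ℕ, k < l ∧ ∃ β : A ≃[L] A,
      act β (W 0) = W 0 ∧ act β (W (6 * k)) = W (6 * l) := by
    -- Infinitely many pairs (W 0, W (6 k)) fall into finitely many orbits.
    have := hcat.finite_orbits (ι ⊕ ι)
    obtain ⟨k, l, hne, heq⟩ := Finite.exists_ne_map_eq_of_infinite fun k : ℕ =>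
      (Quotient.mk (tupleSetoid L A (ι ⊕ ι)) (Sum.elim (W 0) (W (6 * k))))
    have hkl : ∀ k l : ℕ, (Quotient.mk (tupleSetoid L A (ι ⊕ ι)) (Sum.elim (W 0) (W (6 * k)))) =
        Quotient.mk (tupleSetoid L A (ι ⊕ ι)) (Sum.elim (W 0) (W (6 * l))) → ∃ β : A ≃[L] A,
        act β (W 0) = W 0 ∧ act β (W (6 * k)) = W (6 * l) := by
      intro k l heq
      obtain ⟨β, hβ⟩ := Quotient.exact heq
      exact ⟨β, funext fun j => hβ (Sum.inl j), funext fun j => hβ (Sum.inr j)⟩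
    rcases lt_or_gt_of_ne hne with h | h
    · exact ⟨k, l, h, hkl k l heq⟩
    · exact ⟨l, k, h, hkl l k heq.symm⟩
  set P := 6 * l + 6 * k with hPdef
  have hP : 0 < P := by omega
  have hPe : Even P := ⟨3 * l + 3 * k, by omega⟩
  -- Out along W up to time 6 l, where the image under β of W at time 6 k is met, and back along
  -- that image to the fixed tuple W 0. The two pieces contribute l and -k to the height.
  let E : ℕ → ι → A := fun j => if j ≤ 6 * l then W j else act β (W (P - j))
  have hE1 : ∀ j ≤ 6 * l, E j = W j := fun j hj => if_pos hj
  have hE2 : ∀ j, 6 * l ≤ j → E j = act β (W (P - j)) := by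
    intro j hj
    rcases hj.eq_or_lt with rfl | hj
    · rw [hE1 _ le_rfl, show P - 6 * l = 6 * k by omega, hβ1]
    · exact if_neg (by omega)
  have hE0 : E P = E 0 := by
    rw [hE1 0 (by omega), hE2 P (by omega), Nat.sub_self, hβ0]
  have hEadj : ∀ i < P, G (E i) (E (i + 1)) := by
    intro i hi
    rcases Nat.lt_or_ge i (6 * l) with h | h
    · rw [hE1 i h.le, hE1 (i + 1) h]; exact hWadj i
    · rw [hE2 i h, hE2 (i + 1) (by omega)]
      obtain ⟨t, ht⟩ : ∃ t, P - i = t + 1 := ⟨P - i - 1, by omega⟩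
      rw [ht, show P - (i + 1) = t by omega]
      exact hs _ _ (hG.adj_act β (hWadj t))
  have hheight : walkHeight h P E 0 = l - k := by
    have hsplit : walkHeight h P E 0 =
        walkHeight h (6 * l) W 0 + walkHeight h (6 * k) (fun i => act β (W (6 * k - i))) 0 := by
      rw [walkHeight, hPdef, Finset.sum_range_add]
      congr 1
      · refine Finset.sum_congr rfl fun i hi => ?_
        have := Finset.mem_range.mp hi
        rw [hE1 i (by omega), hE1 (i + 1) (by omega)]
      · refine Finset.sum_congr rfl fun i hi => ?_
        have := Finset.mem_range.mp hi
        rw [hE2 _ (by omega), hE2 _ (by omega), show P - (6 * l + i) = 6 * k - i by omega,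
          show P - (6 * l + i + 1) = 6 * k - (i + 1) by omega,
          show 6 * l + i + 0 = i + 0 + 6 * l by ring, arc_add_even ⟨3 * l, by ring⟩]
    have hrev : walkHeight h (6 * k) (fun i => act β (W (6 * k - i))) 0 =
        walkHeight h (6 * k) (fun i => W (6 * k - i)) 0 :=
      Finset.sum_congr rfl fun i _ =>
        arcorb _ (sameOrbit_act β _).symm (sameOrbit_act β _).symm
    rw [hsplit, hrev, walkHeight_reverse (γ := W) ⟨3 * k, by ring⟩ fun i _ => rfl, hht, hht]
    ring
  have D : HeightData L G h (E 0) (W 1) P :=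
    ⟨hs, hG, hh, horb, by rw [hE1 0 (by omega)]; exact hWadj 0, hPe, hP⟩
  refine D.interpretsAll hcore hcat (isLoop_mod hP hEadj hE0) ?_
  rw [walkHeight_mod hE0, hheight]
  omega

end Triangle

/-! ### Reduction to a minimal odd graph -/

section WalkLemmas

variable {X : Type*} {r : X → X → Prop}

theorem Walk.split {m n : ℕ} {x y : X} (h : Walk r (m + n) x y) :
    ∃ z, Walk r m x z ∧ Walk r n z y := by
  induction n generalizing y with
  | zero => exact ⟨y, h, rfl⟩
  | succ n ih =>
    obtain ⟨z, h1, h2⟩ := h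
    obtain ⟨t, h3, h4⟩ := ih h1
    exact ⟨t, h3, z, h4, h2⟩

theorem Walk.exists_rel {n : ℕ} {x y : X} (h : Walk r (n + 1) x y) : ∃ z, r x z := by
  rw [Nat.add_comm] at h
  obtain ⟨z, ⟨_, rfl, hz⟩, -⟩ := h.split
  exact ⟨z, hz⟩

/-- A nonempty walk can be prolonged by an even number of steps. -/
theorem Walk.prolong (hr : ∀ x y, r x y → r y x) {n : ℕ} {x y : X} (h : Walk r (n + 1) x y)
    (j : ℕ) : Walk r (n + 1 + 2 * j) x y := by
  induction j with
  | zero => exact h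
  | succ j ih =>
    obtain ⟨z, hz⟩ := (h.symm hr).exists_rel
    exact ⟨z, ⟨y, ih, hz⟩, hr _ _ hz⟩

end WalkLemmas

section Minimal

variable {L : FirstOrder.Language.{v, w}} {A : Type u} [L.Structure A] {ι : Type*}

/-- The orbit of a tuple. -/
def orbitOf (L : FirstOrder.Language.{v, w}) {A : Type u} [L.Structure A] {ι : Type*}
    (x : ι → A) : Quotient (tupleSetoid L A ι) := Quotient.mk _ x

theorem orbitOf_eq_iff {x y : ι → A} : orbitOf L x = orbitOf L y ↔ SameOrbit L x y :=
  ⟨fun h => Quotient.exact h, fun h => Quotient.sound h⟩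

theorem exists_orbitOf (p : Quotient (tupleSetoid L A ι)) : ∃ x, orbitOf L x = p :=
  Quotient.exists_rep p

/-- The sets of orbits whose union is preserved by all polymorphisms. -/
def invariantSets (L : FirstOrder.Language.{v, w}) (A : Type u) [L.Structure A] (ι : Type*) :
    Set (Set (Quotient (tupleSetoid L A ι))) :=
  {U | IsInvariant L (∅ : Set A) {x : ι → A | orbitOf L x ∈ U}}

/-- An invariant symmetric graph whose vertices lie in the orbits in `U`, where no two adjacent
vertices lie in the same orbit and some walk of odd length joins two vertices in the same orbit. -/
structure IsOddGraph (U : Set (Quotient (tupleSetoid L A ι))) (G : (ι → A) → (ι → A) → Prop) :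
    Prop where
  symm : ∀ x y, G x y → G y x
  inv : IsInvariantGraph L G
  mem : ∀ x y, G x y → orbitOf L x ∈ U
  not_sameOrbit : ∀ x y, G x y → ¬ SameOrbit L x y
  odd : ∃ n x y, Odd n ∧ Walk G n x y ∧ SameOrbit L x y

theorem IsInvariantGraph.walk {G : (ι → A) → (ι → A) → Prop} (hG : IsInvariantGraph L G)
    (n : ℕ) : IsInvariantGraph L (Walk G n) := by
  intro m f hf r r' hr
  induction n generalizing r' with
  | zero => exact congrArg (lift f) (funext hr)
  | succ n ih =>
    choose z hz1 hz2 using hr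
    exact ⟨lift f z, ih z hz1, hG f hf z r' hz2⟩

/-- An odd graph can be replaced by one that contains a triangle up to orbits. -/
theorem IsOddGraph.exists_triangle {U : Set (Quotient (tupleSetoid L A ι))}
    {G : (ι → A) → (ι → A) → Prop} (hG : IsOddGraph U G) :
    ∃ G', IsOddGraph (L := L) U G' ∧ ∃ x y, Walk G' 3 x y ∧ SameOrbit L x y := by
  classical
  have hex : ∃ n, Odd n ∧ ∃ x y, Walk G n x y ∧ SameOrbit L x y := by
    obtain ⟨n, x, y, h1, h2⟩ := hG.odd
    exact ⟨n, h1, x, y, h2⟩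
  obtain ⟨n, ⟨hodd, x, y, hw, hxy⟩, hmin⟩ :
      ∃ n, (Odd n ∧ ∃ x y, Walk G n x y ∧ SameOrbit L x y) ∧
        ∀ m < n, ¬ (Odd m ∧ ∃ x y, Walk G m x y ∧ SameOrbit L x y) :=
    ⟨Nat.find hex, Nat.find_spec hex, fun m hm => Nat.find_min hex hm⟩
  obtain ⟨j, rfl⟩ := hodd
  have hj : j ≠ 0 := by
    rintro rfl
    obtain ⟨z, hz, hzy⟩ := hw
    obtain rfl : x = z := hz
    exact hG.not_sameOrbit x y hzy hxy
  obtain ⟨i, rfl⟩ := Nat.exists_eq_succ_of_ne_zero hj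
  -- The shortest odd walk between tuples of one orbit has length 2 i + 3. Prolonged by 4 i steps,
  -- it splits into three walks of length 2 i + 1, a length that is too short for an edge of the new
  -- graph to stay inside an orbit.
  have h3 : ∃ x y, Walk (Walk G (2 * i + 1)) 3 x y ∧ SameOrbit L x y := by
    have hw' : Walk G (2 * i + 1 + (2 * i + 1) + (2 * i + 1)) x y := by
      have := Walk.prolong hG.symm (n := 2 * (i + 1)) hw (2 * i)
      rwa [show 2 * (i + 1) + 1 + 2 * (2 * i) = 2 * i + 1 + (2 * i + 1) + (2 * i + 1) by ring]
        at this
    obtain ⟨s, h1, h2⟩ := hw'.split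
    obtain ⟨t, h3, h4⟩ := h1.split
    exact ⟨x, y, ⟨s, ⟨t, ⟨x, rfl, h3⟩, h4⟩, h2⟩, hxy⟩
  refine ⟨Walk G (2 * i + 1), ⟨fun x y h => h.symm hG.symm, IsInvariantGraph.walk hG.inv _, ?_, ?_, ?_⟩, h3⟩
  · intro x y h
    obtain ⟨z, hz⟩ := h.exists_rel
    exact hG.mem x z hz
  · intro x y h hxy
    exact hmin (2 * i + 1) (by omega) ⟨⟨i, rfl⟩, x, y, h, hxy⟩
  · obtain ⟨x, y, h⟩ := h3
    exact ⟨3, x, y, by decide, h⟩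

/-- The graph induced on the orbits. -/
def orbitGraph (L : FirstOrder.Language.{v, w}) {A : Type u} [L.Structure A] {ι : Type*}
    (G : (ι → A) → (ι → A) → Prop) (p q : Quotient (tupleSetoid L A ι)) : Prop :=
  ∃ x y, orbitOf L x = p ∧ orbitOf L y = q ∧ G x y

theorem IsInvariantGraph.exists_lift {G : (ι → A) → (ι → A) → Prop} (hG : IsInvariantGraph L G)
    {x : ι → A} {q : Quotient (tupleSetoid L A ι)} (h : orbitGraph L G (orbitOf L x) q) :
    ∃ y, orbitOf L y = q ∧ G x y := by
  obtain ⟨x', y', hx, rfl, hxy⟩ := h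
  obtain ⟨α, rfl⟩ := (orbitOf_eq_iff.mp hx).exists_act
  exact ⟨act α y', orbitOf_eq_iff.mpr (sameOrbit_act α y').symm, hG.adj_act α hxy⟩

theorem IsOddGraph.exists_lift {U : Set (Quotient (tupleSetoid L A ι))}
    {G : (ι → A) → (ι → A) → Prop} (hG : IsOddGraph U G) {x : ι → A}
    {q : Quotient (tupleSetoid L A ι)} (h : orbitGraph L G (orbitOf L x) q) :
    ∃ y, orbitOf L y = q ∧ G x y :=
  IsInvariantGraph.exists_lift hG.inv h

theorem isInvariant_singleton [L.IsRelational] [Finite ι] (hcore : IsModelCompleteCore L A)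
    (p : Quotient (tupleSetoid L A ι)) : {p} ∈ invariantSets L A ι := by
  intro m f hf _ r hr
  obtain ⟨t, rfl⟩ := exists_orbitOf p
  exact orbitOf_eq_iff.mpr (hf.sameOrbit hcore fun i =>
    (orbitOf_eq_iff.mp (Set.mem_singleton_iff.mp (hr i))).symm).symm

/-- An odd closed walk of orbits inside U lifts to a walk of tuples ending in its initial orbit, so
G restricted to U would be a smaller odd graph. Increasing unions stay invariant because
polymorphisms have finite arity. -/
theorem IsOddGraph.minimalGraph [L.IsRelational] [Finite ι] (hcore : IsModelCompleteCore L A)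
    {U₀ : Set (Quotient (tupleSetoid L A ι))} {G : (ι → A) → (ι → A) → Prop}
    (hG : IsOddGraph U₀ G)
    (hmin : ∀ U ∈ invariantSets L A ι, U ⊆ U₀ → U ≠ U₀ → ∀ G', ¬ IsOddGraph (L := L) U G') :
    MinimalGraph (orbitGraph L G) U₀ (invariantSets L A ι) where
  symm := by
    rintro p q ⟨x, y, hx, hy, h⟩
    exact ⟨y, x, hy, hx, hG.symm _ _ h⟩
  irrefl := by
    rintro p ⟨x, y, rfl, hy, h⟩
    exact hG.not_sameOrbit x y h (orbitOf_eq_iff.mp hy.symm)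
  left_mem := by
    rintro p q ⟨x, y, rfl, rfl, h⟩
    exact hG.mem x y h
  singleton p _ := isInvariant_singleton hcore p
  inter U hU V hV := fun f hf hfC r hr =>
    ⟨hU f hf hfC r fun i => (hr i).1, hV f hf hfC r fun i => (hr i).2⟩
  nbr U hU := by
    intro m f hf hfC r hr
    choose q hqU hq using hr
    choose y hy hxy using fun i => hG.exists_lift (hq i)
    exact ⟨orbitOf L (lift f y), hU f hf hfC y fun i => by
      change orbitOf L (y i) ∈ U
      rw [hy i]; exact hqU i, lift f r, lift f y, rfl, rfl, hG.inv f hf r y hxy⟩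
  union s hmono hs := by
    intro m f hf hfC r hr
    choose n hn using fun i => Set.mem_iUnion.mp (hr i)
    refine Set.mem_iUnion.mpr ⟨Finset.univ.sup n, hs _ f hf hfC r fun i => ?_⟩
    exact hmono (Finset.le_sup (Finset.mem_univ i)) (hn i)
  minimal := by
    intro U hU hUU hne n p hn hw
    let G' : (ι → A) → (ι → A) → Prop := fun x y => G x y ∧ orbitOf L x ∈ U ∧ orbitOf L y ∈ U
    have hlift : ∀ {n : ℕ} {x : ι → A} {q : Quotient (tupleSetoid L A ι)},
        Walk (induced (orbitGraph L G) U) n (orbitOf L x) q →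
        ∃ y, orbitOf L y = q ∧ Walk G' n x y := by
      intro n x q h
      induction n generalizing q with
      | zero => exact ⟨x, h, rfl⟩
      | succ n ih =>
        obtain ⟨q', h1, h2, h3, h4⟩ := h
        obtain ⟨y, rfl, hy⟩ := ih h1
        obtain ⟨z, rfl, hz⟩ := hG.exists_lift h2
        exact ⟨z, rfl, y, hy, hz, h3, h4⟩
    obtain ⟨x, rfl⟩ := exists_orbitOf p
    obtain ⟨y, hy, hxy⟩ := hlift hw
    refine hmin U hU hUU hne G' ⟨fun x y h => ⟨hG.symm _ _ h.1, h.2.2, h.2.1⟩, ?_,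
      fun x y h => h.2.1, fun x y h => hG.not_sameOrbit x y h.1, n, x, y, hn, hxy,
      orbitOf_eq_iff.mp hy.symm⟩
    intro m f hf r r' hr
    exact ⟨hG.inv f hf r r' fun i => (hr i).1,
      hU f hf (fun c hc => absurd hc (Set.notMem_empty c)) r fun i => (hr i).2.1,
      hU f hf (fun c hc => absurd hc (Set.notMem_empty c)) r' fun i => (hr i).2.2⟩

/-- A structure with an invariant graph without pseudoloops that contains a walk of odd length
between two tuples in the same orbit interprets all finite structures with parameters. -/
theorem IsOddGraph.interpretsAll [L.IsRelational] [Finite ι] [Nonempty ι]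
    (hcat : IsOmegaCategorical L A) (hcore : IsModelCompleteCore L A)
    {G : (ι → A) → (ι → A) → Prop} (hG : IsOddGraph (L := L) Set.univ G) :
    PPInterpretsAllFiniteWithParameters L A := by
  classical
  have := hcat.finite_orbits ι
  obtain ⟨U₀, ⟨hU₀, G₀, hG₀⟩, hmin⟩ := Set.Finite.exists_minimal
    (s := {U | U ∈ invariantSets L A ι ∧ ∃ G', IsOddGraph (L := L) U G'}) (Set.toFinite _)
    ⟨Set.univ, fun _ _ _ _ _ => Set.mem_univ _, G, hG⟩
  obtain ⟨G', hG', x, x', ⟨z, ⟨y, ⟨_, rfl, hxy⟩, hyz⟩, hzx⟩, hx⟩ := hG₀.exists_triangle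
  have hM := hG'.minimalGraph hcore fun U hU hUU hne G'' hG'' =>
    hne (hUU.antisymm (hmin ⟨hU, G'', hG''⟩ hUU))
  have hmk : ∀ {x y}, G' x y → orbitGraph L G' (orbitOf L x) (orbitOf L y) :=
    fun {x y} h => ⟨x, y, rfl, rfl, h⟩
  obtain ⟨h, hh, p, a, b, hpa, hab, hbp, hval⟩ := hM.exists_isHeight
    ⟨orbitOf L x, orbitOf L y, orbitOf L z, hmk hxy, hmk hyz, by
      rw [orbitOf_eq_iff.mpr hx]; exact hmk hzx⟩
  obtain ⟨x₀, rfl⟩ := exists_orbitOf p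
  obtain ⟨x₁, rfl, h01⟩ := hG'.exists_lift hpa
  obtain ⟨x₂, rfl, h12⟩ := hG'.exists_lift hab
  obtain ⟨x₃, h3, h23⟩ := hG'.exists_lift hbp
  refine interpretsAll_of_triangle hcat hcore hG'.symm hG'.inv
    (h := fun x y => h (orbitOf L x) (orbitOf L y)) ?_ ?_ h01 h12 h23
    (orbitOf_eq_iff.mp h3.symm) hval
  · intro x y x' y' h1 h2 h3 h4
    exact hh _ _ _ _ (hmk h1) (hmk h2) (hmk h3) (hmk h4)
  · intro x x' y y' hx hy
    rw [orbitOf_eq_iff.mpr hx, orbitOf_eq_iff.mpr hy]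

end Minimal

/-! ### Pseudoloop conditions and their triviality -/

section Conditions

variable {V : Type} [Finite V] (B : Digraph V)

/-- The first vertex of the `k`-th edge. -/
noncomputable def edgeSource (k : Fin (Nat.card (Edge B))) : V := (edgeList B k).1.1

/-- The second vertex of the `k`-th edge. -/
noncomputable def edgeTarget (k : Fin (Nat.card (Edge B))) : V := (edgeList B k).1.2

theorem adj_edge (k : Fin (Nat.card (Edge B))) : B.Adj (edgeSource B k) (edgeTarget B k) :=
  (edgeList B k).2

theorem exists_edge {i j : V} (h : B.Adj i j) :
    ∃ k, edgeSource B k = i ∧ edgeTarget B k = j := by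
  refine ⟨(edgeList B).symm ⟨(i, j), h⟩, ?_, ?_⟩ <;>
    simp only [edgeSource, edgeTarget, Equiv.apply_symm_apply]

/-- The interpretation of the symbols of a pseudoloop condition by operations. -/
@[reducible] def pseudoloopStructure {A : Type u} {m : ℕ} (u v : (Fin 1 → A) → A) (s : (Fin m → A) → A) :
    (pseudoloopLanguage m).Structure A where
  funMap := fun f => match f with
    | .u => u
    | .v => v
    | .s => s
  RelMap := fun R => nomatch R

theorem polSatisfies_pseudoloopCondition_iff {L : FirstOrder.Language.{v, w}} {A : Type u}
    [L.Structure A] : PolSatisfies L A (pseudoloopCondition B) ↔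
    ∃ (s : (Fin (Nat.card (Edge B)) → A) → A) (u v : (Fin 1 → A) → A),
      IsPoly L s ∧ IsPoly L u ∧ IsPoly L v ∧ ∀ ρ : V → A,
        u (fun _ => s fun k => ρ (edgeSource B k)) = v fun _ => s fun k => ρ (edgeTarget B k) := by
  constructor
  · rintro ⟨I, hI, hid⟩
    exact ⟨I.funMap (PseudoloopSymbol.s : PseudoloopSymbol _ _),
      I.funMap (n := 1) (PseudoloopSymbol.u : PseudoloopSymbol _ _),
      I.funMap (n := 1) (PseudoloopSymbol.v : PseudoloopSymbol _ _), hI _, hI _, hI _,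
      fun ρ => hid _ rfl ρ⟩
  · rintro ⟨s, u, v, hs, hu, hv, hid⟩
    refine ⟨pseudoloopStructure u v s, fun f => ?_, ?_⟩
    · cases f with
      | u => exact hu
      | v => exact hv
      | s => exact hs
    · rintro _ rfl ρ
      exact hid ρ

/-- A pseudoloop condition for a digraph with a loop is trivial. -/
theorem isTrivial_of_loop {i : V} (h : B.Adj i i) : (pseudoloopCondition B).IsTrivial := by
  intro L _ A _
  obtain ⟨k, hk, hk'⟩ := exists_edge B h
  refine (polSatisfies_pseudoloopCondition_iff B).mpr ⟨fun x => x k, fun x => x 0, fun x => x 0,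
    isPoly_proj k, isPoly_proj 0, isPoly_proj 0, fun ρ => ?_⟩
  change ρ (edgeSource B k) = ρ (edgeTarget B k)
  rw [hk, hk']

/-- The language with a symbol for every relation on `Bool`. -/
def boolLanguage : FirstOrder.Language.{0, 0} := ⟨fun _ => Empty, fun n => Set (Fin n → Bool)⟩

instance : boolLanguage.IsRelational := fun _ => inferInstanceAs (IsEmpty Empty)

/-- The structure on `Bool` with all relations. -/
instance boolStructure : boolLanguage.Structure Bool where
  funMap := fun f => nomatch f
  RelMap := fun {n} (R : Set (Fin n → Bool)) x => x ∈ R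

/-- The `m` coordinate functions, as tuples indexed by `Bool ^ m`. -/
def projRel {m n : ℕ} (e : (Fin m → Bool) ≃ Fin n) : Set (Fin n → Bool) :=
  {x | ∃ i, ∀ β, x (e β) = β i}

/-- The pseudoloop condition of a digraph without loops is nontrivial. -/
theorem not_isTrivial_of_loopless (h : ∀ i, ¬ B.Adj i i) :
    ¬ (pseudoloopCondition B).IsTrivial := by
  classical
  intro htriv
  obtain ⟨s, u, v, hs, hu, hv, hid⟩ :=
    (polSatisfies_pseudoloopCondition_iff B).mp (htriv boolLanguage Bool)
  let e := Finite.equivFin (Fin (Nat.card (Edge B)) → Bool)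
  -- The rows list the coordinate functions on all Boolean vectors, so preserving `projRel e` says
  -- that s is a projection.
  have hproj : (fun j => s fun i => e.symm j i) ∈ projRel e :=
    hs (projRel e : boolLanguage.Relations _) (fun i t => e.symm t i) fun i =>
      (⟨i, fun β => by simp⟩ : (fun t => e.symm t i) ∈ projRel e)
  obtain ⟨k, hk⟩ := hproj
  simp only [Equiv.symm_apply_apply] at hk
  have hun : ∀ (f : (Fin 1 → Bool) → Bool), IsPoly boolLanguage f → ∀ b, (f fun _ => b) = b :=
    fun f hf b => hf ({x | x 0 = b} : Set (Fin 1 → Bool)) (fun _ _ => b) fun _ => rfl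
  have := hid fun x => decide (x = edgeSource B k)
  rw [hun u hu, hun v hv, hk, hk] at this
  have h1 := adj_edge B k
  have h2 : edgeTarget B k = edgeSource B k := by simpa using this
  rw [h2] at h1
  exact h _ h1

end Conditions

/-! ### A nontrivial pseudoloop condition prevents interpretations -/

section Preservation

variable {L : FirstOrder.Language.{v, w}} [L.IsRelational] {A : Type u} [L.Structure A]

theorem realize_term_lift {ι : Type*} {σ : Type*} (f : (σ → A) → A)
    (t : (L.sum (paramLanguage A)).Term ι) (x : σ → ι → A) :
    t.realize (lift f x) = f fun i => t.realize (x i) := by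
  cases t with
  | var i => rfl
  | func g ts =>
    rcases g with g | g
    · exact isEmptyElim g
    · exact nomatch g

/-- Polymorphisms that fix the finitely many parameters preserve pp-definable relations. -/
theorem exists_finset_preserved {ι : Type*} {S : Set (ι → A)}
    (hS : PPDefinable (L.sum (paramLanguage A)) S) :
    ∃ C : Finset A, IsInvariant L (C : Set A) S := by
  classical
  obtain ⟨φ, hφ, hreal⟩ := hS
  have key : ∀ {n : ℕ} (φ : (L.sum (paramLanguage A)).BoundedFormula ι n),
      IsPrimitivePositive φ → ∃ C : Finset A, ∀ {m : ℕ} (f : (Fin m → A) → A), IsPoly L f →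
        Fixes f (C : Set A) → ∀ (x : Fin m → ι → A) (y : Fin m → Fin n → A),
        (∀ i, φ.Realize (x i) (y i)) → φ.Realize (lift f x) (lift f y) := by
    intro n φ hφ
    induction hφ with
    | @atomic n φ h =>
      have helim : ∀ {m : ℕ} (f : (Fin m → A) → A) (x : Fin m → ι → A) (y : Fin m → Fin n → A),
          Sum.elim (lift f x) (lift f y) = lift f fun i => Sum.elim (x i) (y i) := by
        intro m f x y
        funext j
        cases j <;> rfl
      cases h with
      | equal t₁ t₂ =>
        refine ⟨∅, fun f _ _ x y h => ?_⟩
        rw [BoundedFormula.realize_bdEqual, helim, realize_term_lift, realize_term_lift]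
        exact congrArg f (funext fun i => BoundedFormula.realize_bdEqual _ _ |>.mp (h i))
      | rel R ts =>
        rcases R with R | R
        · refine ⟨∅, fun f hf _ x y h => ?_⟩
          have hrel : RelMap R fun j => (ts j).realize (Sum.elim (lift f x) (lift f y)) := by
            simp only [helim, realize_term_lift]
            exact hf R _ fun i => h i
          exact hrel
        · cases R with
          | single a =>
            refine ⟨{a}, fun f _ hfC x y h => ?_⟩
            have h' : ∀ i, (ts 0).realize (Sum.elim (x i) (y i)) = a := fun i => h i
            have hrel : (ts 0).realize (Sum.elim (lift f x) (lift f y)) = a := by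
              simp only [helim, realize_term_lift, h']
              exact hfC a (by simp)
            exact hrel
    | top => exact ⟨∅, fun f _ _ x y _ => BoundedFormula.realize_top.mpr trivial⟩
    | inf _ _ ih₁ ih₂ =>
      obtain ⟨C₁, h₁⟩ := ih₁
      obtain ⟨C₂, h₂⟩ := ih₂
      refine ⟨C₁ ∪ C₂, fun f hf hfC x y h => BoundedFormula.realize_inf.mpr ⟨?_, ?_⟩⟩
      · exact h₁ f hf (fun c hc => hfC c (by simp [Finset.mem_coe.mp hc])) x y fun i =>
          (BoundedFormula.realize_inf.mp (h i)).1
      · exact h₂ f hf (fun c hc => hfC c (by simp [Finset.mem_coe.mp hc])) x y fun i =>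
          (BoundedFormula.realize_inf.mp (h i)).2
    | ex _ ih =>
      obtain ⟨C, hC⟩ := ih
      refine ⟨C, fun f hf hfC x y h => ?_⟩
      choose a ha using fun i => BoundedFormula.realize_ex.mp (h i)
      refine BoundedFormula.realize_ex.mpr ⟨f a, ?_⟩
      have := hC f hf hfC x (fun i => Fin.snoc (y i) (a i)) ha
      convert this using 1
      funext j
      refine Fin.lastCases ?_ (fun j => ?_) j
      · simp [lift]
      · simp [lift]
  obtain ⟨C, hC⟩ := key φ hφ
  refine ⟨C, fun f hf hfC r hr => (hreal _).mp ?_⟩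
  have := hC f hf hfC r (fun _ => default) fun i => (hreal _).mpr (hr i)
  rwa [Subsingleton.elim (lift f fun _ => default) default] at this

/-- A structure that satisfies a nontrivial pseudoloop condition does not interpret all finite
structures with parameters. -/
theorem not_interpretsAll_of_polSatisfies (hcore : IsModelCompleteCore L A) {V : Type} [Finite V]
    (B : Digraph V) (hB : ∀ i, ¬ B.Adj i i) (hsat : PolSatisfies L A (pseudoloopCondition B)) :
    ¬ PPInterpretsAllFiniteWithParameters L A := by
  classical
  intro hall
  obtain ⟨d, h, hh⟩ := hall boolLanguage Bool
  let e := Finite.equivFin (Fin (Nat.card (Edge B)) → Bool)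
  have hdef : ∀ {n : ℕ} (R : Set (Fin n → Bool)),
      ∃ C : Finset A, IsInvariant L (C : Set A) (preimageRel h R) :=
    fun {n} R => exists_finset_preserved (hh.relations (n := n) (R : Set (Fin n → Bool)))
  obtain ⟨C₁, hC₁⟩ := hdef (projRel e)
  choose C₂ hC₂ using fun b : Bool => hdef {x : Fin 1 → Bool | x 0 = b}
  let C := C₁ ∪ (C₂ false ∪ C₂ true)
  obtain ⟨s, u, v, hs, hu, hv, hid⟩ := (polSatisfies_pseudoloopCondition_iff B).mp hsat
  -- On constant tuples s is an endomorphism, so its composition with the inverse of some α fixes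
  -- the parameters; u ∘ α is likewise corrected by β. The identity at constant evaluations shows
  -- that the same β corrects v ∘ α.
  obtain ⟨α, hα⟩ := hcore (endOfPoly hs fun _ => Language.Equiv.refl L A) C
  have hα' : ∀ c ∈ C, (s fun _ => c) = α c := hα
  have hu₁ : IsPoly L fun x : Fin 1 → A => u fun _ => α (x 0) :=
    hu.comp (g := fun _ x => α (x 0)) fun _ => isPoly_equiv_comp (f := fun x : Fin 1 → A => x 0) α (isPoly_proj 0)
  have hv₁ : IsPoly L fun x : Fin 1 → A => v fun _ => α (x 0) :=
    hv.comp (g := fun _ x => α (x 0)) fun _ => isPoly_equiv_comp (f := fun x : Fin 1 → A => x 0) α (isPoly_proj 0)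
  obtain ⟨β, hβ⟩ := hcore (endOfPoly (f := fun x : Fin 1 → A => u fun _ => α (x 0)) hu₁ fun _ => Language.Equiv.refl L A) C
  have hβ' : ∀ c ∈ C, (u fun _ => α c) = β c := hβ
  have hs' : IsPoly L fun x => α.symm (s x) := isPoly_equiv_comp α.symm hs
  have hsC : Fixes (fun x => α.symm (s x)) (C : Set A) := fun c hc =>
    (congrArg α.symm (hα' c hc)).trans (α.symm_apply_apply c)
  have hu' : IsPoly L fun x : Fin 1 → A => β.symm (u fun _ => α (x 0)) :=
    isPoly_equiv_comp (f := fun x : Fin 1 → A => u fun _ => α (x 0)) β.symm hu₁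
  have hv' : IsPoly L fun x : Fin 1 → A => β.symm (v fun _ => α (x 0)) :=
    isPoly_equiv_comp (f := fun x : Fin 1 → A => v fun _ => α (x 0)) β.symm hv₁
  have huC : Fixes (fun x : Fin 1 → A => β.symm (u fun _ => α (x 0))) (C : Set A) := fun c hc =>
    (congrArg β.symm (hβ' c hc)).trans (β.symm_apply_apply c)
  have hvC : Fixes (fun x : Fin 1 → A => β.symm (v fun _ => α (x 0))) (C : Set A) := fun c hc => by
    have h1 := hid fun _ => c
    rw [hα' c hc] at h1
    exact (congrArg β.symm (h1.symm.trans (hβ' c hc))).trans (β.symm_apply_apply c)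
  have hid' : ∀ ρ : V → A, β.symm (u fun _ => α (α.symm (s fun k => ρ (edgeSource B k)))) =
      β.symm (v fun _ => α (α.symm (s fun k => ρ (edgeTarget B k)))) := by
    intro ρ
    simp only [Language.Equiv.apply_symm_apply]
    exact congrArg β.symm (hid ρ)
  choose y hy using hh.surj
  -- Applied to codes of all Boolean vectors at once, the corrected s acts on codes as the
  -- projection to some k.
  obtain ⟨b, ⟨k, hk⟩, hb⟩ := hC₁ (fun x => α.symm (s x)) hs' (fun c hc => hsC c (by
    simp only [C, Finset.coe_union]; exact Or.inl hc))
    (fun i p => y (e.symm p.1 i) p.2) fun i => ⟨fun t => e.symm t i, ⟨i, fun β => by simp⟩,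
      fun t => hy (e.symm t i)⟩
  have hb' : ∀ β : Fin (Nat.card (Edge B)) → Bool,
      β k ∈ h fun j => α.symm (s fun i => y (β i) j) := by
    intro β
    have := hb (e β)
    rw [hk β] at this
    simpa [lift] using this
  let ρ : Fin d → V → A := fun j x => y (decide (x = edgeSource B k)) j
  have h1 := hb' fun i => decide (edgeSource B i = edgeSource B k)
  have h2 := hb' fun i => decide (edgeTarget B i = edgeSource B k)
  have hne : edgeTarget B k ≠ edgeSource B k := fun h => hB _ (h ▸ adj_edge B k)
  simp only [decide_true] at h1
  rw [decide_eq_false hne] at h2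
  have hun : ∀ (b : Bool) (f : (Fin 1 → A) → A), IsPoly L f → Fixes f (C : Set A) →
      ∀ z : Fin d → A, b ∈ h z → b ∈ h fun j => f fun _ => z j := by
    intro b f hf hfC z hz
    obtain ⟨b', hb', hbz⟩ := hC₂ b f hf (fun c hc => hfC c (by
      simp only [C, Finset.coe_union]
      cases b
      · exact Or.inr (Or.inl hc)
      · exact Or.inr (Or.inr hc))) (fun _ p => z p.2) fun _ => ⟨fun _ => b, rfl, fun _ => hz⟩
    have h0 := hbz 0
    rw [show b' 0 = b from hb'] at h0
    exact h0
  have h3 := hun true _ hu' huC _ h1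
  have h4 := hun false _ hv' hvC _ h2
  have heq : (fun j => β.symm (u fun _ => α (α.symm (s fun i =>
      y (decide (edgeSource B i = edgeSource B k)) j)))) =
      fun j => β.symm (v fun _ => α (α.symm (s fun i =>
      y (decide (edgeTarget B i = edgeSource B k)) j))) :=
    funext fun j => hid' (ρ j)
  rw [heq] at h3
  exact absurd (Part.mem_unique h3 h4) (by decide)

end Preservation

/-! ### Local satisfaction and the passage to global identities -/

/-- A symmetric graph that is not bipartite has a closed walk of odd length. -/
theorem exists_odd_closed_walk {V : Type*} {r : V → V → Prop} (hr : ∀ x y, r x y → r y x)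
    (h : ¬ ∃ c : V → Bool, ∀ x y, r x y → c x ≠ c y) : ∃ n x, Odd n ∧ Walk r n x x := by
  classical
  by_contra! hno
  let S : Setoid V :=
    { r := fun x y => ∃ n, Walk r n x y
      iseqv := ⟨fun x => ⟨0, rfl⟩, fun ⟨n, h⟩ => ⟨n, h.symm hr⟩,
        fun ⟨m, h⟩ ⟨n, k⟩ => ⟨m + n, h.append k⟩⟩ }
  let rep : V → V := fun x => (Quotient.mk S x).out
  -- Without odd closed walks, the parity of walks from a representative of the component is a
  -- proper 2-colouring.
  refine h ⟨fun x => decide (∃ n, Even n ∧ Walk r n (rep x) x), fun x y hxy => ?_⟩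
  have hrep : rep x = rep y :=
    congrArg Quotient.out (Quotient.sound (s := S) ⟨1, walk_one hxy⟩)
  obtain ⟨k, hk⟩ : ∃ k, Walk r k (rep x) x := Quotient.mk_out (s := S) x
  intro hc
  have hc' := decide_eq_decide.mp hc
  rcases Nat.even_or_odd k with hev | hodd
  · obtain ⟨n, hn, hw⟩ := hc'.mp ⟨k, hev, hk⟩
    rw [← hrep] at hw
    exact hno _ _ ((hev.add_one).add_even hn)
      ((hk.append (walk_one hxy)).append (hw.symm hr))
  · obtain ⟨n, hn, hw⟩ := hc'.mpr
      ⟨k + 1, hodd.add_one, hrep ▸ hk.append (walk_one hxy)⟩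
    exact hno _ _ (hn.add_odd hodd) (hw.append (hk.symm hr))

theorem Walk.map {T U : Type*} {r : T → T → Prop} {q : U → U → Prop} (g : T → U)
    (hg : ∀ x y, r x y → q (g x) (g y)) {n : ℕ} {x y : T} (h : Walk r n x y) :
    Walk q n (g x) (g y) := by
  induction n generalizing y with
  | zero => exact congrArg g h
  | succ n ih =>
    obtain ⟨z, h1, h2⟩ := h
    exact ⟨g z, ih h1, hg _ _ h2⟩

variable {L : FirstOrder.Language.{v, w}} {A : Type u} [L.Structure A]

/-- A pseudoloop condition for a symmetric graph that is not bipartite holds on every finite set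
of evaluations, with an automorphism in place of the unary symbols. -/
theorem exists_isPoly_sameOrbit [L.IsRelational] (hcat : IsOmegaCategorical L A)
    (hcore : IsModelCompleteCore L A) (hall : ¬ PPInterpretsAllFiniteWithParameters L A)
    {V : Type} [Finite V] (B : Digraph V) (hB : ∀ x y, B.Adj x y → B.Adj y x)
    (hbip : ¬ IsBipartite B) (P : Finset (V → A)) :
    ∃ s : (Fin (Nat.card (Edge B)) → A) → A, IsPoly L s ∧ ∃ α : A ≃[L] A, ∀ ρ ∈ P,
      α (s fun k => ρ (edgeSource B k)) = s fun k => ρ (edgeTarget B k) := by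
  obtain ⟨n, x, hn, hw⟩ := exists_odd_closed_walk hB hbip
  -- If there are no evaluations, any projection will do; one exists because an odd walk uses an
  -- edge.
  rcases P.eq_empty_or_nonempty with rfl | hP
  · obtain ⟨i, rfl⟩ : ∃ i, n = i + 1 := Nat.exists_eq_add_one.mpr hn.pos
    obtain ⟨z, -, hz⟩ := hw
    obtain ⟨k, -⟩ := exists_edge B hz
    exact ⟨fun x => x k, isPoly_proj k, Language.Equiv.refl L A, fun ρ hρ => absurd hρ (by simp)⟩
  by_contra! hcon
  have : Nonempty P := hP.to_subtype
  -- This is the invariant graph generated by the image of B in A ^ P. Failure of the claim says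
  -- exactly that no edge of it lies inside an orbit.
  let G : (P → A) → (P → A) → Prop := fun x y =>
    ∃ s : (Fin (Nat.card (Edge B)) → A) → A, IsPoly L s ∧
      (x = fun ρ => s fun k => ρ.1 (edgeSource B k)) ∧ y = fun ρ => s fun k => ρ.1 (edgeTarget B k)
  have hG : IsOddGraph (L := L) Set.univ G := by
    refine ⟨?_, ?_, fun _ _ _ => Set.mem_univ _, ?_, ?_⟩
    · rintro _ _ ⟨s, hs, rfl, rfl⟩
      choose rev hrev hrev' using fun k => exists_edge B (hB _ _ (adj_edge B k))
      exact ⟨fun x => s fun k => x (rev k), hs.reindex rev, by simp only [hrev],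
        by simp only [hrev']⟩
    · intro m f hf r r' h
      choose s hs hr hr' using h
      refine ⟨fun x => f fun i => s i x, IsPoly.comp hf hs, ?_, ?_⟩
      · funext ρ
        simp only [lift, hr]
      · funext ρ
        simp only [lift, hr']
    · rintro _ _ ⟨s, hs, rfl, rfl⟩ ⟨α, hα⟩
      obtain ⟨ρ, hρ, hne⟩ := hcon s hs α
      exact hne (hα ⟨ρ, hρ⟩)
    · refine ⟨n, _, _, hn, hw.map (fun v (ρ : P) => ρ.1 v) fun i j hij => ?_, SameOrbit.refl _⟩
      obtain ⟨k, rfl, rfl⟩ := exists_edge B hij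
      exact ⟨fun x => x k, isPoly_proj k, rfl, rfl⟩
  exact hall (hG.interpretsAll hcat hcore)

/-- A constraint is a local condition. -/
theorem isLocal_sat {σ : Type*} {I : Type*} (e : (σ → A) → I) (c : Constraint L A σ) :
    IsLocal L {g : I → A | c.Sat fun x => g (e x)} := by
  classical
  refine ⟨Finset.univ.image fun j => e fun i => c.rows i j, ?_⟩
  rintro g g' ⟨α, hα⟩ hg
  have : lift (fun x => g' (e x)) c.rows = fun j => α (lift (fun x => g (e x)) c.rows j) :=
    funext fun j => (hα _ (Finset.mem_image_of_mem _ (Finset.mem_univ j))).symm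
  change RelMap c.rel (lift (fun x => g' (e x)) c.rows)
  rw [this]
  exact (α.map_rel c.rel _).mpr hg

/-- Composing s with an automorphism β conjugates α by β, so the condition on a finite set of
evaluations is local and compactness applies. -/
theorem exists_isPoly_forall_sameOrbit (hcat : IsOmegaCategorical L A) {V : Type} [Finite V]
    {m : ℕ} (a b : Fin m → V)
    (hloc : ∀ P : Finset (V → A), ∃ s : (Fin m → A) → A, IsPoly L s ∧ ∃ α : A ≃[L] A,
      ∀ ρ ∈ P, α (s fun k => ρ (a k)) = s fun k => ρ (b k)) :
    ∃ s : (Fin m → A) → A, IsPoly L s ∧ ∀ P : Finset (V → A), ∃ α : A ≃[L] A,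
      ∀ ρ ∈ P, α (s fun k => ρ (a k)) = s fun k => ρ (b k) := by
  classical
  have hcount : Countable A := hcat.1
  let S : Constraint L A (Fin m) ⊕ Finset (V → A) → Set ((Fin m → A) → A) :=
    Sum.elim (fun c => {s | c.Sat fun x => s x}) fun P =>
      {s | ∃ α : A ≃[L] A, ∀ ρ ∈ P, α (s fun k => ρ (a k)) = s fun k => ρ (b k)}
  obtain ⟨s, hs⟩ : ∃ s, ∀ j, s ∈ S j := by
    refine exists_mem_of_isLocal hcat S ?_ ?_
    · rintro (c | P)
      · exact isLocal_sat id c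
      · refine ⟨(P.image fun ρ k => ρ (a k)) ∪ P.image fun ρ k => ρ (b k), ?_⟩
        rintro g g' ⟨β, hβ⟩ ⟨α, hα⟩
        refine ⟨(β.comp α).comp β.symm, fun ρ hρ => ?_⟩
        rw [← hβ _ (Finset.mem_union_left _ (Finset.mem_image_of_mem _ hρ)),
          ← hβ _ (Finset.mem_union_right _ (Finset.mem_image_of_mem _ hρ)), ← hα ρ hρ]
        simp only [Language.Equiv.comp_apply, Language.Equiv.symm_apply_apply]
    · intro F
      obtain ⟨s, hs, α, hα⟩ := hloc (F.biUnion (Sum.elim (fun _ => ∅) id))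
      refine ⟨s, ?_⟩
      rintro (c | P) hj
      · exact isPoly_iff_sat.mp hs c
      · exact ⟨α, fun ρ hρ => hα ρ (Finset.mem_biUnion.mpr ⟨_, hj, hρ⟩)⟩
  exact ⟨s, isPoly_iff_sat.mpr fun c => hs (Sum.inl c), fun P => hs (Sum.inr P)⟩

/-- Two maps on the same domain that agree up to automorphisms on all finite sets agree up to
unary polymorphisms. -/
theorem exists_unary_isPoly (hcat : IsOmegaCategorical L A) {R : Type*} (p q : R → A)
    (h : ∀ P : Finset R, ∃ α : A ≃[L] A, ∀ ρ ∈ P, α (p ρ) = q ρ) :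
    ∃ u v : (Fin 1 → A) → A, IsPoly L u ∧ IsPoly L v ∧
      ∀ ρ, u (fun _ => p ρ) = v fun _ => q ρ := by
  classical
  have hcount : Countable A := hcat.1
  -- The two unary operations are sought together, as one function on A ⊕ A; on finite sets the
  -- given automorphism and the identity serve.
  let S : (Constraint L A (Fin 1) ⊕ Constraint L A (Fin 1)) ⊕ R → Set (A ⊕ A → A) :=
    Sum.elim (Sum.elim (fun c => {g | c.Sat fun x => g (Sum.inl (x 0))})
      fun c => {g | c.Sat fun x => g (Sum.inr (x 0))})
      fun ρ => {g | g (Sum.inl (p ρ)) = g (Sum.inr (q ρ))}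
  obtain ⟨g, hg⟩ : ∃ g, ∀ j, g ∈ S j := by
    refine exists_mem_of_isLocal hcat S ?_ ?_
    · rintro ((c | c) | ρ)
      · exact isLocal_sat (fun x => Sum.inl (x 0)) c
      · exact isLocal_sat (fun x => Sum.inr (x 0)) c
      · refine ⟨{Sum.inl (p ρ), Sum.inr (q ρ)}, ?_⟩
        rintro g g' ⟨β, hβ⟩ hg
        exact (hβ _ (by simp)).symm.trans ((congrArg β hg).trans (hβ _ (by simp)))
    · intro F
      obtain ⟨α, hα⟩ := h (F.biUnion (Sum.elim (fun _ => ∅) fun ρ => {ρ}))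
      refine ⟨Sum.elim α id, ?_⟩
      rintro ((c | c) | ρ) hj
      · exact isPoly_iff_sat.mp
          (isPoly_equiv_comp (f := fun x : Fin 1 → A => x 0) α (isPoly_proj 0)) c
      · exact isPoly_iff_sat.mp (isPoly_proj (0 : Fin 1)) c
      · exact hα ρ (Finset.mem_biUnion.mpr ⟨_, hj, Finset.mem_singleton_self ρ⟩)
  exact ⟨fun x => g (Sum.inl (x 0)), fun x => g (Sum.inr (x 0)),
    isPoly_iff_sat.mpr fun c => hg (Sum.inl (Sum.inl c)),
    isPoly_iff_sat.mpr fun c => hg (Sum.inl (Sum.inr c)), fun ρ => hg (Sum.inr ρ)⟩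

/-- A structure that does not interpret all finite structures with parameters satisfies the
pseudoloop condition of every symmetric graph that is not bipartite. -/
theorem polSatisfies_of_not_interpretsAll [L.IsRelational] (hcat : IsOmegaCategorical L A)
    (hcore : IsModelCompleteCore L A) (hall : ¬ PPInterpretsAllFiniteWithParameters L A)
    {V : Type} [Finite V] (B : Digraph V) (hB : ∀ x y, B.Adj x y → B.Adj y x)
    (hbip : ¬ IsBipartite B) : PolSatisfies L A (pseudoloopCondition B) := by
  obtain ⟨s, hs, h⟩ := exists_isPoly_forall_sameOrbit hcat (edgeSource B) (edgeTarget B)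
    (exists_isPoly_sameOrbit hcat hcore hall B hB hbip)
  obtain ⟨u, v, hu, hv, huv⟩ := exists_unary_isPoly hcat _ _ h
  exact (polSatisfies_pseudoloopCondition_iff B).mpr ⟨s, u, v, hs, hu, hv, huv⟩

end PseudoloopConditions

open PseudoloopConditions in
theorem mainTheorem3 (L : FirstOrder.Language.{v, w}) [L.IsRelational]
    (A : Type u) [L.Structure A]
    (hcat : IsOmegaCategorical L A) (hcore : IsModelCompleteCore L A) :
    List.TFAE
      [ ¬ PPInterpretsAllFiniteWithParameters L A,
        ∃ (V : Type) (_ : Finite V) (B : Digraph V),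
          ¬ (pseudoloopCondition B).IsTrivial ∧ PolSatisfies L A (pseudoloopCondition B),
        ∀ (V : Type) [Finite V] (B : Digraph V), (∀ x y, B.Adj x y → B.Adj y x) →
          ¬ IsBipartite B → PolSatisfies L A (pseudoloopCondition B) ] := by
  tfae_have 1 → 3 := fun hall V _ B hB hbip =>
    polSatisfies_of_not_interpretsAll hcat hcore hall B hB hbip
  tfae_have 3 → 2 := by
    intro h
    let B : Digraph (Fin 3) := ⟨fun x y => x ≠ y⟩
    have hbip : ¬ IsBipartite B := by
      rintro ⟨c, hc⟩
      have h01 := hc 0 1 (by simp [B])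
      have h02 := hc 0 2 (by simp [B])
      have h12 := hc 1 2 (by simp [B])
      cases h0 : c 0 <;> cases h1 : c 1 <;> cases h2 : c 2 <;> simp_all
    exact ⟨Fin 3, inferInstance, B, not_isTrivial_of_loopless B fun i hi => hi rfl,
      h (Fin 3) B (fun _ _ => Ne.symm) hbip⟩
  tfae_have 2 → 1 := by
    rintro ⟨V, _, B, hB, hsat⟩
    exact not_interpretsAll_of_polSatisfies hcore B
      (fun i hi => hB (isTrivial_of_loop B hi)) hsat
  tfae_finish
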